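/- Let $W=\langle r,s,t\mid r^2=s^2=t^2=(rt)^2=(rs)^4=(st)^5=1\rangle$ be the $(2,4,5)$ triangle Coxeter group. Recall that a simplicial complex is *flag* if every nonempty finite set of pairwise adjacent vertices spans a simplex; it is *6-large* if it is flag and has no full (induced) cycle of length $4$ or $5$; and it is *systolic* if it is connected, simply connected and the link of each of its vertices is 6-large. An action of a group on a simplicial complex is *geometric* if it is a proper and cocompact action by simplicial automorphisms. A *clique* is a set of pairwise adjacent vertices; it is *fixed* by a subgroup $H$ if $hA=A$ (as a set) for all $h\in H$; and $d(A,B)$ is the least distance in the 1-skeleton between a vertex of $A$ and a vertex of $B$. **Proposition.** Suppose that $W$ acts geometrically on a systolic complex $X$. If there exist cliques $A$ and $B$ of $X$ fixed by $\langle s,t\rangle$ and $\langle r,s\rangle$, respectively, such that $d(A,B)=1$, then there exist cliques $A'$ and $B'$ of $X$ fixed by $\langle s,t\rangle$ and $\langle r,s\rangle$, respectively, such that $A'\cap B'\neq\emptyset$. -/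

import Mathlib

open scoped Pointwise

namespace Systolic

variable {V : Type*}

/-- The 1-skeleton of a simplicial complex: two distinct points are adjacent when they lie in a
common face. -/
def oneSkeleton (K : PreAbstractSimplicialComplex V) : SimpleGraph V where
  Adj v w := v ≠ w ∧ ∃ σ ∈ K.faces, v ∈ σ ∧ w ∈ σ
  symm := ⟨fun _ _ h => ⟨h.1.symm, h.2.imp fun _ hσ => ⟨hσ.1, hσ.2.2, hσ.2.1⟩⟩⟩
  loopless := ⟨fun _ h => h.1 rfl⟩

/-- The link of a vertex `v`: the faces `τ` not containing `v` such that `τ ∪ {v}` is a face. -/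
def link (K : PreAbstractSimplicialComplex V) (v : V) : PreAbstractSimplicialComplex V where
  faces := {τ | τ.Nonempty ∧ ∃ h : v ∉ τ, Finset.cons v τ h ∈ K.faces}
  isRelLowerSet_faces := by
    rintro τ ⟨hne, hv, hK⟩
    refine ⟨hne, fun ρ hρ hρne => ⟨hρne, fun h => hv (hρ h), ?_⟩⟩
    exact (K.isRelLowerSet_faces hK).2 (Finset.cons_subset_cons.2 hρ) (Finset.cons_nonempty _)

/-- A complex is flag if every nonempty finite set of vertices, any two of which lie in a common
face, is a face. (For `v = w` the condition says that `v` is a vertex of `K`.) -/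
def IsFlag (K : PreAbstractSimplicialComplex V) : Prop :=
  ∀ σ : Finset V, σ.Nonempty →
    (∀ v ∈ σ, ∀ w ∈ σ, ∃ τ ∈ K.faces, v ∈ τ ∧ w ∈ τ) → σ ∈ K.faces

/-- A complex is `k`-large if it is flag and has no full (that is, induced) cycle of length `n`
with `4 ≤ n < k`. -/
def IsLarge (k : ℕ) (K : PreAbstractSimplicialComplex V) : Prop :=
  IsFlag K ∧ ∀ n : ℕ, 4 ≤ n → n < k → IsEmpty (SimpleGraph.cycleGraph n ↪g oneSkeleton K)

/-- Homotopy of edge paths with fixed end points: the equivalence relation generated by removing a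
backtrack along an edge and by replacing two sides of a 2-simplex by the third side, anywhere in
the path. -/
inductive EdgeHomotopic (K : PreAbstractSimplicialComplex V) :
    ∀ {u v : V}, (oneSkeleton K).Walk u v → (oneSkeleton K).Walk u v → Prop
  | refl {u v : V} (p : (oneSkeleton K).Walk u v) : EdgeHomotopic K p p
  | symm {u v : V} {p q : (oneSkeleton K).Walk u v} :
      EdgeHomotopic K p q → EdgeHomotopic K q p
  | trans {u v : V} {p q r : (oneSkeleton K).Walk u v} :
      EdgeHomotopic K p q → EdgeHomotopic K q r → EdgeHomotopic K p r
  | cons {u v w : V} (h : (oneSkeleton K).Adj u v) {p q : (oneSkeleton K).Walk v w} :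
      EdgeHomotopic K p q → EdgeHomotopic K (.cons h p) (.cons h q)
  | backtrack {u v w : V} (h : (oneSkeleton K).Adj u v) (h' : (oneSkeleton K).Adj v u)
      (p : (oneSkeleton K).Walk u w) : EdgeHomotopic K (.cons h (.cons h' p)) p
  | triangle {a b c w : V} {σ : Finset V} (hσ : σ ∈ K.faces)
      (ha : a ∈ σ) (hb : b ∈ σ) (hc : c ∈ σ)
      (hab : (oneSkeleton K).Adj a b) (hbc : (oneSkeleton K).Adj b c)
      (hac : (oneSkeleton K).Adj a c) (p : (oneSkeleton K).Walk c w) :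
      EdgeHomotopic K (.cons hab (.cons hbc p)) (.cons hac p)

/-- A complex is systolic if it is connected, simply connected (every closed edge path is
null-homotopic) and locally 6-large (every vertex link is 6-large). -/
structure IsSystolic (X : AbstractSimplicialComplex V) : Prop where
  connected : (oneSkeleton X.toPreAbstractSimplicialComplex).Connected
  simplyConnected : ∀ (v : V) (p : (oneSkeleton X.toPreAbstractSimplicialComplex).Walk v v),
    EdgeHomotopic X.toPreAbstractSimplicialComplex p .nil
  locally_large : ∀ v : V, IsLarge 6 (link X.toPreAbstractSimplicialComplex v)

/-- The image of a finite set of vertices under the action of a group element. -/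
def translate {W : Type*} [Group W] [MulAction W V] (g : W) (σ : Finset V) : Finset V :=
  σ.map (MulAction.toPerm g).toEmbedding

/-- A geometric action on a simplicial complex, i.e. a proper and cocompact action by simplicial
automorphisms. Cocompactness means finitely many orbits of simplices; given that, properness means
that every simplex has a finite (setwise) stabilizer, which also forces local finiteness. -/
structure IsGeometricAction (W : Type*) [Group W] [MulAction W V]
    (X : AbstractSimplicialComplex V) : Prop where
  simplicial : ∀ g : W, ∀ σ ∈ X.faces, translate g σ ∈ X.faces
  proper : ∀ σ ∈ X.faces, {g : W | translate g σ = σ}.Finite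
  cocompact : ∃ F : Set (Finset V), F.Finite ∧ F ⊆ X.faces ∧
    ∀ σ ∈ X.faces, ∃ g : W, ∃ τ ∈ F, translate g τ = σ

/-- The distance between two sets of vertices of a graph: the least combinatorial distance between
a vertex of the first and a vertex of the second (`⊤` if there is no connecting path). -/
noncomputable def setDist (G : SimpleGraph V) (A B : Set V) : ℕ∞ :=
  ⨅ a ∈ A, ⨅ b ∈ B, G.edist a b

/-- The Coxeter matrix of the (2,4,5) triangle group
`W = ⟨r, s, t | r² = s² = t² = (rt)² = (rs)⁴ = (st)⁵ = 1⟩`, with `r, s, t` indexed by `0, 1, 2`. -/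
def triangle245 : CoxeterMatrix (Fin 3) where
  M := !![1, 4, 2;
          4, 1, 5;
          2, 5, 1]
  off_diagonal := by
    intro i j h
    fin_cases i <;> fin_cases j <;> simp_all

end Systolic

/-!
Only three features of the situation matter: the relations of `W`, the fact that `W` acts by
automorphisms of the 1-skeleton `G`, and the metric of `G`. Call two vertices near if their distance
is at most 1.

*From local to global.* The metric properties of `G` come from a covering of the complex, built
sphere by sphere around a base vertex `u` (`Layer.next`). A vertex of the next sphere is a missing
neighbour `z` of vertices `w` of the current one; the new vertices over `z` above `w` and above an
adjacent `w'` are identified when `z`, `w`, `w'` form a face. That this is an equivalence relation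
(`Layer.Good.same_trans`) is where links without full cycles of length 4 and 5 are used. In the
covering, the lower neighbours of a vertex are pairwise adjacent and the two ends of an edge inside
a sphere have a common lower neighbour. Edge homotopies lift, so by simple connectivity the covering
is the complex itself. Hence `G` satisfies the interval and triangle conditions of bridged graphs
with respect to every vertex (`IsSystolic.bridged`), and as consequences the rules for short closed
walks: a closed walk of length 4 has a short diagonal (`Bridged.quad`), and in a closed walk of
length 5 the two neighbours of a vertex without short diagonals are near (`Bridged.ear`).

*Orbits.* By these rules the orbit of a vertex `v` under the dihedral group `⟨s, t⟩` is a clique as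
soon as `v` is near `s v` and `s v` is near `t v`; likewise for `⟨r, s⟩`
(`near_smul_of_mem_closure`). So it suffices to find `b ∈ B` with `s b` near `t b`, or `a ∈ A` with
`s a` near `r a`, or a vertex `c` for which both orbits are cliques (`Meets`).

*The quadrilateral.* Let `a ∈ A` and `b ∈ B` be near. The cliques `A`, `B`, `r A`, `t B` form a
cycle that `r` and `t` preserve, and the situation is symmetric under exchanging `A` with `B` and
`r` with `t`. If `b` is near `t b`, or `a` near `r a`, or `a` near both `r b` and `t b`, closed walks of
length 4 and 5 suffice (`Config.meets_of_near_T`, `Config.meets_of_both`). Otherwise the images of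
`a` and `b` under `⟨r, t⟩` contain a full cycle of length 6 or 8. The metric conditions provide a
vertex near all of them (`Config.meets_of_not_near`), and every such vertex is a suitable `c`
(`Config.meets_of_around`).
-/

namespace Systolic

universe u

variable {V : Type u}

/-! ### Building a covering sphere by sphere -/

/-- A graph `G` together with a set `T` of filled triangles, satisfying the local conditions that
a simplicial complex with 6-large vertex links imposes on its 2-skeleton. The relation `T x` is
adjacency in the link of `x`; `tetra` is flagness of links, `quad` and `pent` forbid full cycles of
length 4 and 5 in links. -/
structure LocallyLarge (G : SimpleGraph V) (T : V → V → V → Prop) : Prop where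
  rot : ∀ {a b c}, T a b c → T b c a
  swap : ∀ {a b c}, T a b c → T a c b
  adj : ∀ {a b c}, T a b c → G.Adj a b
  tetra : ∀ {a b c d}, T a b c → T a b d → T a c d → T b c d
  quad : ∀ {x a b c d}, T x a b → T x b c → T x c d → T x d a → a ≠ c → b ≠ d →
    T x a c ∨ T x b d
  pent : ∀ {x a b c d e}, T x a b → T x b c → T x c d → T x d e → T x e a →
    a ≠ c → b ≠ d → c ≠ e → d ≠ a → e ≠ b →
    T x a c ∨ T x b d ∨ T x c e ∨ T x d a ∨ T x e b

namespace LocallyLarge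

variable {G : SimpleGraph V} {T : V → V → V → Prop} {a b c : V}

theorem rotr (hG : LocallyLarge G T) (h : T a b c) : T c a b := hG.rot (hG.rot h)

theorem swapl (hG : LocallyLarge G T) (h : T a b c) : T b a c := hG.swap (hG.rot h)

theorem rev (hG : LocallyLarge G T) (h : T a b c) : T c b a := hG.rot (hG.swap h)

theorem ne (hG : LocallyLarge G T) (h : T a b c) : a ≠ b ∧ a ≠ c ∧ b ≠ c :=
  ⟨(hG.adj h).ne, (hG.adj (hG.swap h)).ne, (hG.adj (hG.rot h)).ne⟩

end LocallyLarge

/-- Two consecutive spheres of a covering of `G` which is built sphere by sphere. `Cur` is the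
current sphere, `Prev` the preceding one, `fc` and `fp` are the projections to `G`, `H` is
adjacency inside `Cur`, and `D` is adjacency between `Cur` and `Prev`. -/
structure Layer (V : Type u) where
  Prev : Type u
  Cur : Type u
  fp : Prev → V
  fc : Cur → V
  H : Cur → Cur → Prop
  D : Cur → Prev → Prop

namespace Layer

/-- The vertex `z` is the projection of a neighbour of `w` in the part already built. -/
def Covered (L : Layer V) (w : L.Cur) (z : V) : Prop :=
  (∃ w', L.H w w' ∧ L.fc w' = z) ∨ ∃ p, L.D w p ∧ L.fp p = z

/-- The vertex `z` is adjacent to the projection of `w`, and the edge over it has not been built. -/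
def Free (G : SimpleGraph V) (L : Layer V) (w : L.Cur) (z : V) : Prop :=
  G.Adj (L.fc w) z ∧ ¬ L.Covered w z

/-- The new vertices over `z` that lie above `w` and above `w'` have to be the same one. -/
def Same (G : SimpleGraph V) (T : V → V → V → Prop) (L : Layer V) (z : V) (w w' : L.Cur) : Prop :=
  L.Free G w' z ∧ (w = w' ∨ L.H w w' ∧ T z (L.fc w) (L.fc w'))

/-- The next sphere. A vertex of it is a vertex `z` of `G` together with a class of vertices of the
current sphere, the lower neighbours of the new vertex. -/
def next (G : SimpleGraph V) (T : V → V → V → Prop) (L : Layer V) : Layer V where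
  Prev := L.Cur
  Cur := {c : V × Set L.Cur // ∃ w, L.Free G w c.1 ∧ c.2 = {w' | L.Same G T c.1 w w'}}
  fp := L.fc
  fc := fun c => c.1.1
  H := fun c c' => ∃ w, w ∈ c.1.2 ∧ w ∈ c'.1.2 ∧ T (L.fc w) c.1.1 c'.1.1
  D := fun c w => w ∈ c.1.2

/-- The conditions under which the construction of the covering can be continued: the projection is
injective on the neighbours of a vertex `w` of the current sphere, two neighbours of `w` are
adjacent if and only if their projections are so in the link, and the lower neighbours of vertices
and of edges behave as in a complex with convex balls. -/
structure Good (G : SimpleGraph V) (T : V → V → V → Prop) (L : Layer V) : Prop where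
  symm : ∀ {w w'}, L.H w w' → L.H w' w
  adjH : ∀ {w w'}, L.H w w' → G.Adj (L.fc w) (L.fc w')
  adjD : ∀ {w p}, L.D w p → G.Adj (L.fc w) (L.fp p)
  injHH : ∀ {w a b}, L.H w a → L.H w b → L.fc a = L.fc b → a = b
  injDD : ∀ {w a b}, L.D w a → L.D w b → L.fp a = L.fp b → a = b
  injHD : ∀ {w a b}, L.H w a → L.D w b → L.fc a ≠ L.fp b
  fullHH : ∀ {w a b}, L.H w a → L.H w b → a ≠ b → (L.H a b ↔ T (L.fc w) (L.fc a) (L.fc b))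
  fullHD : ∀ {w a p}, L.H w a → L.D w p → (L.D a p ↔ T (L.fc w) (L.fc a) (L.fp p))
  fullDD : ∀ {w p q}, L.D w p → L.D w q → p ≠ q → T (L.fc w) (L.fp p) (L.fp q)
  covered : ∀ {w p z}, L.D w p → T z (L.fc w) (L.fp p) → L.Covered w z
  tri : ∀ {w w'}, L.H w w' → ∃ p, L.D w p ∧ L.D w' p

variable {G : SimpleGraph V} {T : V → V → V → Prop} {L : Layer V}

/-- If `z`, `w`, `w'` span a filled triangle and `z` is already covered at `w'`, then it is covered
at `w`. -/
theorem Good.covered_of (hG : LocallyLarge G T) (hL : L.Good G T) {w w' : L.Cur} {z : V}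
    (hw : L.H w w') (hT : T z (L.fc w) (L.fc w')) (hc : L.Covered w' z) : L.Covered w z := by
  rcases hc with ⟨q, hq, rfl⟩ | ⟨p, hp, rfl⟩
  · have hne : w ≠ q := fun h => (hG.ne hT).1 (by rw [h])
    exact Or.inl ⟨q, (hL.fullHH (hL.symm hw) hq hne).2 (hG.swap (hG.rotr hT)), rfl⟩
  · exact Or.inr ⟨p, (hL.fullHD (hL.symm hw) hp).2 (hG.swap (hG.rotr hT)), rfl⟩

theorem Good.free_of (hG : LocallyLarge G T) (hL : L.Good G T) {w w' : L.Cur} {z : V}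
    (hw : L.H w w') (hT : T z (L.fc w) (L.fc w')) (hc : L.Free G w z) : L.Free G w' z :=
  ⟨hG.adj (hG.rotr hT), fun h => hc.2 (hL.covered_of hG hw hT h)⟩

/-- `Same` is transitive. The two lower edges of a chain `w`, `w'`, `w''` have lower neighbours, and
these together with `z`, `w` and `w''` form a cycle of length 4 or 5 in the link of `w'`. -/
theorem Good.same_trans (hG : LocallyLarge G T) (hL : L.Good G T) {w w' w'' : L.Cur} {z : V}
    (h : L.Same G T z w w') (h' : L.Same G T z w' w'') :
    L.Same G T z w w'' := by
  obtain ⟨f', rfl | ⟨hw, hT⟩⟩ := h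
  · exact h'
  obtain ⟨f'', rfl | ⟨hw', hT'⟩⟩ := h'
  · exact ⟨f', Or.inr ⟨hw, hT⟩⟩
  refine ⟨f'', ?_⟩
  by_cases hne : w = w''
  · exact Or.inl hne
  right
  have hww := hL.symm hw
  suffices hK : T (L.fc w') (L.fc w) (L.fc w'') from
    ⟨(hL.fullHH hww hw' hne).2 hK,
      hG.tetra (hG.rotr hT) (hG.swapl hT') hK⟩
  obtain ⟨p, hp, hp'⟩ := hL.tri hw
  obtain ⟨q, hq', hq⟩ := hL.tri hw'
  have hzw : T (L.fc w') z (L.fc w) := hG.rotr hT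
  have hzw'' : T (L.fc w') (L.fc w'') z := hG.rot hT'
  have hwp : T (L.fc w') (L.fc w) (L.fp p) := (hL.fullHD hww hp').1 hp
  have hwq : T (L.fc w') (L.fc w'') (L.fp q) := (hL.fullHD hw' hq').1 hq
  -- `z` is free at `w'`, hence not adjacent in the link of `w'` to a lower neighbour of `w'`
  have hz : ∀ {p}, L.D w' p → ¬ T (L.fc w') z (L.fp p) := fun hp h =>
    f'.2 (hL.covered hp (hG.swapl h))
  have hzp : ∀ {p}, L.D w' p → z ≠ L.fp p := fun {p} hp h => f'.2 (Or.inr ⟨p, hp, h.symm⟩)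
  have hne' : L.fc w ≠ L.fc w'' := fun h => hne (hL.injHH hww hw' h)
  -- a chord from `w` to the second lower neighbour leaves a cycle of length 4
  have key : ∀ {q}, L.D w' q → T (L.fc w') (L.fc w) (L.fp q) →
      T (L.fc w') (L.fc w'') (L.fp q) → T (L.fc w') (L.fc w) (L.fc w'') := by
    intro q hq' h1 h2
    rcases hG.quad hzw h1 (hG.swap h2) hzw'' (hzp hq') hne' with h | h
    · exact (hz hq' h).elim
    · exact h
  by_cases hpq : p = q
  · subst hpq
    exact key hp' hwp hwq
  rcases hG.pent hzw hwp (hL.fullDD hp' hq' hpq) (hG.swap hwq) hzw'' (hzp hp')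
    (hL.injHD hww hq') (hL.injHD hw' hp').symm (hzp hq').symm hne'.symm with h | h | h | h | h
  · exact (hz hp' h).elim
  · exact key hq' h hwq
  · exact key hp' hwp (hG.swap h)
  · exact (hz hq' (hG.swap h)).elim
  · exact hG.swap h

theorem Good.same_symm (hG : LocallyLarge G T) (hL : L.Good G T) {w w' : L.Cur} {z : V}
    (h0 : L.Free G w z) (h : L.Same G T z w w') : L.Same G T z w' w :=
  ⟨h0, h.2.imp Eq.symm fun h => ⟨hL.symm h.1, hG.swap h.2⟩⟩

theorem free_of_mem {c : (L.next G T).Cur} {w : L.Cur} (h : w ∈ c.1.2) : L.Free G w c.1.1 := by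
  obtain ⟨⟨z, S⟩, w₀, h₀, hS⟩ := c
  obtain rfl : S = {w' | L.Same G T z w₀ w'} := hS
  exact h.1

/-- A class of lower neighbours is determined by any of its members. -/
theorem Good.mem_iff (hG : LocallyLarge G T) (hL : L.Good G T) {c : (L.next G T).Cur}
    {w w' : L.Cur} (h : w ∈ c.1.2) : w' ∈ c.1.2 ↔ L.Same G T c.1.1 w w' := by
  obtain ⟨⟨z, S⟩, w₀, h₀, hS⟩ := c
  obtain rfl : S = {w' | L.Same G T z w₀ w'} := hS
  have h : L.Same G T z w₀ w := h
  exact ⟨fun h' => hL.same_trans hG (hL.same_symm hG h₀ h) h',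
    fun h' => hL.same_trans hG h h'⟩

theorem Good.eq_of_mem (hG : LocallyLarge G T) (hL : L.Good G T) {c c' : (L.next G T).Cur}
    {w : L.Cur} (h : w ∈ c.1.2) (h' : w ∈ c'.1.2) (hz : c.1.1 = c'.1.1) : c = c' := by
  refine Subtype.ext (Prod.ext hz (Set.ext fun x => ?_))
  rw [hL.mem_iff hG h, hL.mem_iff hG h', hz]

theorem exists_class {w : L.Cur} {z : V} (h : L.Free G w z) :
    ∃ c : (L.next G T).Cur, c.1.1 = z ∧ w ∈ c.1.2 :=
  ⟨⟨(z, {w' | L.Same G T z w w'}), w, h, rfl⟩, rfl, h, Or.inl rfl⟩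

theorem nonempty_class (c : (L.next G T).Cur) : ∃ w, w ∈ c.1.2 := by
  obtain ⟨⟨z, S⟩, w₀, h₀, hS⟩ := c
  obtain rfl : S = {w' | L.Same G T z w₀ w'} := hS
  exact ⟨w₀, h₀, Or.inl rfl⟩

theorem Good.pair (hG : LocallyLarge G T) (hL : L.Good G T) {c : (L.next G T).Cur}
    {w w' : L.Cur} (h : w ∈ c.1.2) (h' : w' ∈ c.1.2) (hne : w ≠ w') :
    L.H w w' ∧ T c.1.1 (L.fc w) (L.fc w') :=
  (((hL.mem_iff hG h).1 h').2).resolve_left hne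

theorem Good.mem_of (hG : LocallyLarge G T) (hL : L.Good G T) {c : (L.next G T).Cur}
    {w w' : L.Cur} (h : w ∈ c.1.2) (hH : L.H w w') (hT : T c.1.1 (L.fc w) (L.fc w')) :
    w' ∈ c.1.2 :=
  (hL.mem_iff hG h).2 ⟨hL.free_of hG hH hT (free_of_mem h), Or.inr ⟨hH, hT⟩⟩

/-- A lower neighbour `w` of the upper end of a horizontal edge is one of the other end too if and
only if the projections of the three vertices span a filled triangle. -/
theorem Good.next_HD (hG : LocallyLarge G T) (hL : L.Good G T) {c c' : (L.next G T).Cur}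
    {w : L.Cur} (hc : (L.next G T).H c c') (hw : w ∈ c.1.2) :
    w ∈ c'.1.2 ↔ T c.1.1 c'.1.1 (L.fc w) := by
  obtain ⟨w₀, h₀, h₀', hT⟩ := hc
  by_cases hne : w₀ = w
  · subst hne
    exact iff_of_true h₀' (hG.rot hT)
  obtain ⟨hH, hTw⟩ := hL.pair hG h₀ hw hne
  constructor
  · intro hw'
    obtain ⟨-, hTw'⟩ := hL.pair hG h₀' hw' hne
    exact hG.tetra hT (hG.swapl hTw) (hG.swapl hTw')
  · intro h
    exact hL.mem_of hG h₀' hH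
      (hG.tetra (hG.rot hT) h hTw)

/-- Two new vertices with a common lower neighbour `w` are adjacent if and only if they form a
filled triangle with `w`. -/
theorem Good.next_H_iff (hG : LocallyLarge G T) (hL : L.Good G T) {c c' : (L.next G T).Cur}
    {w : L.Cur} (hw : w ∈ c.1.2) (hw' : w ∈ c'.1.2) :
    (L.next G T).H c c' ↔ T (L.fc w) c.1.1 c'.1.1 :=
  ⟨fun h => hG.rotr (((hL.next_HD hG h hw).1 hw')), fun h => ⟨w, hw, hw', h⟩⟩

theorem next_symm (hG : LocallyLarge G T) {c c' : (L.next G T).Cur}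
    (h : (L.next G T).H c c') : (L.next G T).H c' c := by
  obtain ⟨w, h, h', hT⟩ := h
  exact ⟨w, h', h, hG.swap hT⟩

/-- Two new neighbours of a new vertex are adjacent if and only if the three vertices project to a
filled triangle. A triangle of new vertices is reduced to one with a common lower neighbour by means
of a cycle of length 4 in a link. -/
theorem Good.next_HH (hG : LocallyLarge G T) (hL : L.Good G T) {c a b : (L.next G T).Cur}
    (hca : (L.next G T).H c a) (hcb : (L.next G T).H c b) :
    (L.next G T).H a b ↔ T c.1.1 a.1.1 b.1.1 := by
  -- the case of a common lower neighbour
  have common : ∀ w, w ∈ c.1.2 → w ∈ a.1.2 → w ∈ b.1.2 →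
      ((L.next G T).H a b ↔ T c.1.1 a.1.1 b.1.1) := by
    intro w hc ha hb
    have h1 := (hL.next_H_iff hG hc ha).1 hca
    have h2 := (hL.next_H_iff hG hc hb).1 hcb
    rw [hL.next_H_iff hG ha hb]
    exact ⟨fun h => hG.tetra h1 h2 h, fun h => hG.tetra (hG.swapl h1) (hG.swapl h2) h⟩
  obtain ⟨w₁, h1c, h1a, hT1⟩ := id hca
  obtain ⟨w₂, h2c, h2b, hT2⟩ := id hcb
  by_cases h12 : w₁ = w₂
  · subst h12
    exact common _ h1c h1a h2b
  obtain ⟨hH12, hT12⟩ := hL.pair hG h1c h2c h12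
  constructor
  · rintro ⟨w₃, h3a, h3b, hT3⟩
    by_cases h13 : w₁ = w₃
    · subst h13
      exact (common _ h1c h1a h3b).1 ⟨_, h3a, h3b, hT3⟩
    by_cases h23 : w₂ = w₃
    · subst h23
      exact (common _ h2c h3a h2b).1 ⟨_, h3a, h3b, hT3⟩
    obtain ⟨hH13, hT13⟩ := hL.pair hG h1a h3a h13
    obtain ⟨hH23, hT23⟩ := hL.pair hG h2b h3b h23
    have h123 := (hL.fullHH hH12 hH13 h23).1 hH23
    by_cases hw2a : w₂ ∈ a.1.2
    · exact (common _ h2c hw2a h2b).1 ⟨_, h3a, h3b, hT3⟩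
    have hw3c : w₃ ∈ c.1.2 := by
      refine hL.mem_of hG h1c hH13 ?_
      have hza : c.1.1 ≠ L.fc w₃ := fun h =>
        (free_of_mem h1c).2 (Or.inl ⟨w₃, hH13, h.symm⟩)
      have haz : a.1.1 ≠ L.fc w₂ := fun h =>
        (free_of_mem h1a).2 (Or.inl ⟨w₂, hH12, h.symm⟩)
      rcases hG.quad hT1 (hG.swapl hT13) (hG.swap h123) (hG.rot hT12)
        hza haz with h | h
      · exact hG.swapl h
      · exact (hw2a (hL.mem_of hG h1a hH12 (hG.swapl h))).elim
    exact (common _ hw3c h3a h3b).1 ⟨_, h3a, h3b, hT3⟩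
  · intro hT
    have h2 : w₂ ∈ a.1.2 ∨ w₁ ∈ b.1.2 := by
      rw [hL.next_HD hG hca h2c, hL.next_HD hG hcb h1c]
      have n1 : L.fc w₁ ≠ b.1.1 := fun h =>
        (free_of_mem h2b).2 (Or.inl ⟨w₁, hL.symm hH12, h⟩)
      have n2 : L.fc w₂ ≠ a.1.1 := fun h =>
        (free_of_mem h1a).2 (Or.inl ⟨w₂, hH12, h⟩)
      rcases hG.quad hT12 (hG.swapl hT2) (hG.swap hT)
        (hG.rot hT1) n1 n2 with h | h
      · exact Or.inr (hG.swap h)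
      · exact Or.inl (hG.swap h)
    rcases h2 with h | h
    · exact (common _ h2c h h2b).2 hT
    · exact (common _ h1c h1a h).2 hT

/-! ### The covering of a locally 6-large complex -/

theorem Good.next (hG : LocallyLarge G T) (hL : L.Good G T) : (L.next G T).Good G T where
  symm := next_symm hG
  adjH := by
    rintro c c' ⟨w, h, h', hT⟩
    exact hG.adj (hG.rot hT)
  adjD := fun {c w} h => (free_of_mem h).1.symm
  injHH := by
    intro c a b hca hcb hab
    obtain ⟨w₀, h0c, h0a, hT0⟩ := hca
    obtain ⟨w₁, h1c, h1b, hT1⟩ := hcb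
    by_cases h : w₀ = w₁
    · subst h
      exact hL.eq_of_mem hG h0a h1b hab
    obtain ⟨hH, hT⟩ := hL.pair hG h0c h1c h
    have hab' : a.1.1 = b.1.1 := hab
    rw [← hab'] at hT1
    exact hL.eq_of_mem hG (hL.mem_of hG h0a hH
      (hG.rotr (hG.tetra hT (hG.swapl hT0) (hG.swapl hT1)))) h1b hab
  injDD := by
    intro c a b ha hb hab
    by_contra h
    exact (hG.ne (hL.pair hG ha hb h).2).2.2 hab
  injHD := by
    rintro c a b ⟨w₀, h0c, h0a, hT0⟩ hb hab
    have hab : a.1.1 = L.fc b := hab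
    by_cases h : w₀ = b
    · subst h
      exact (hG.ne hT0).2.1 hab.symm
    · exact (free_of_mem h0a).2 (Or.inl ⟨b, (hL.pair hG h0c hb h).1, hab.symm⟩)
  fullHH := fun hca hcb _ => hL.next_HH hG hca hcb
  fullHD := fun hca hw => hL.next_HD hG hca hw
  fullDD := fun ha hb h => (hL.pair hG ha hb h).2
  covered := by
    intro c w z hw hT
    have hT : T z c.1.1 (L.fc w) := hT
    have hw : w ∈ c.1.2 := hw
    by_cases hc : L.Covered w z
    · rcases hc with ⟨q, hq, rfl⟩ | ⟨p, hp, rfl⟩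
      · exact Or.inr ⟨q, hL.mem_of hG hw hq (hG.rot hT), rfl⟩
      · exact ((free_of_mem hw).2 (hL.covered hp (hG.rot hT))).elim
    · obtain ⟨c', rfl, hc'⟩ := exists_class (T := T) (L := L) (w := w) (z := z)
        ⟨hG.adj (hG.rotr hT), hc⟩
      exact Or.inl ⟨c', ⟨w, hw, hc', hG.rev hT⟩, rfl⟩
  tri := by
    rintro c c' ⟨w, h, h', -⟩
    exact ⟨w, h, h'⟩

/-- The sphere of radius 0: a single vertex over `u`. -/
def base (u : V) : Layer V where
  Prev := PUnit
  Cur := PUnit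
  fp := fun _ => u
  fc := fun _ => u
  H := fun _ _ => False
  D := fun _ _ => False

theorem good_base (u : V) : (base u).Good G T := by
  constructor <;> simp [base]

/-- The `n`-th sphere of the covering based at `u`. -/
def stage (G : SimpleGraph V) (T : V → V → V → Prop) (u : V) : ℕ → Layer V
  | 0 => base u
  | n + 1 => (stage G T u n).next G T

theorem good_stage (hG : LocallyLarge G T) (u : V) : ∀ n, (stage G T u n).Good G T
  | 0 => good_base u
  | n + 1 => (good_stage hG u n).next hG

end Layer

open Layer

variable {G : SimpleGraph V} {T : V → V → V → Prop} {u : V}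

/-- The vertices of the covering based at `u`, each with its distance from the base vertex. -/
def Cover (G : SimpleGraph V) (T : V → V → V → Prop) (u : V) : Type u :=
  Σ n, (stage G T u n).Cur

namespace Cover

/-- The covering projection. -/
def proj (p : Cover G T u) : V := (stage G T u p.1).fc p.2

/-- Adjacency in the covering: inside a sphere, or between a vertex `c` of a sphere and a vertex `w`
of the preceding one. -/
inductive CAdj : Cover G T u → Cover G T u → Prop
  | horiz {n : ℕ} {a b : (stage G T u n).Cur} (h : (stage G T u n).H a b) : CAdj ⟨n, a⟩ ⟨n, b⟩
  | up {n : ℕ} {w : (stage G T u n).Cur} {c : (stage G T u (n + 1)).Cur}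
      (h : (stage G T u (n + 1)).D c w) : CAdj ⟨n, w⟩ ⟨n + 1, c⟩
  | down {n : ℕ} {w : (stage G T u n).Cur} {c : (stage G T u (n + 1)).Cur}
      (h : (stage G T u (n + 1)).D c w) : CAdj ⟨n + 1, c⟩ ⟨n, w⟩

theorem CAdj.symm (hG : LocallyLarge G T) {p q : Cover G T u} (h : CAdj p q) : CAdj q p := by
  cases h with
  | horiz h => exact .horiz ((good_stage hG u _).symm h)
  | up h => exact .down h
  | down h => exact .up h

theorem CAdj.adj (hG : LocallyLarge G T) {p q : Cover G T u} (h : CAdj p q) :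
    G.Adj p.proj q.proj := by
  cases h with
  | horiz h => exact (good_stage hG u _).adjH h
  | up h => exact ((good_stage hG u (_ + 1)).adjD h).symm
  | down h => exact (good_stage hG u (_ + 1)).adjD h

theorem CAdj.le {p q : Cover G T u} (h : CAdj p q) : q.1 ≤ p.1 + 1 := by
  cases h <;> dsimp only <;> omega

theorem exists_cadj (p : Cover G T u) {z : V} (hz : G.Adj p.proj z) :
    ∃ q, CAdj p q ∧ q.proj = z := by
  obtain ⟨n, w⟩ := p
  by_cases hc : (stage G T u n).Covered w z
  · rcases hc with ⟨q, hq, rfl⟩ | ⟨p, hp, rfl⟩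
    · exact ⟨⟨n, q⟩, .horiz hq, rfl⟩
    · cases n with
      | zero => exact hp.elim
      | succ n => exact ⟨⟨n, p⟩, .down hp, rfl⟩
  · obtain ⟨c, rfl, hwc⟩ := exists_class (T := T) (L := stage G T u n) ⟨hz, hc⟩
    exact ⟨⟨n + 1, c⟩, .up hwc, rfl⟩

theorem CAdj.eq (hG : LocallyLarge G T) {p q q' : Cover G T u} (h : CAdj p q) (h' : CAdj p q')
    (he : q.proj = q'.proj) : q = q' := by
  cases h with
  | @horiz n a b h =>
    cases h' with
    | horiz h' => rw [(good_stage hG u _).injHH h h' he]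
    | up h' => exact ((free_of_mem h').2 (Or.inl ⟨_, h, he⟩)).elim
    | down h' => exact ((good_stage hG u (_ + 1)).injHD h h' he).elim
  | @up n w c h =>
    cases h' with
    | horiz h' => exact ((free_of_mem h).2 (Or.inl ⟨_, h', he.symm⟩)).elim
    | up h' => rw [(good_stage hG u _).eq_of_mem hG h h' he]
    | down h' => exact ((free_of_mem h).2 (Or.inr ⟨_, h', he.symm⟩)).elim
  | @down n w c h =>
    cases h' with
    | horiz h' => exact ((good_stage hG u (_ + 1)).injHD h' h he.symm).elim
    | up h' => exact ((free_of_mem h').2 (Or.inr ⟨_, h, he⟩)).elim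
    | down h' => rw [(good_stage hG u (_ + 1)).injDD h h' he]

/-- Two neighbours of a vertex of the covering are adjacent if their projections are adjacent in the
link. -/
theorem CAdj.of_T (hG : LocallyLarge G T) {p q q' : Cover G T u} (h : CAdj p q) (h' : CAdj p q')
    (hT : T p.proj q.proj q'.proj) : CAdj q q' := by
  -- a lower neighbour of `p` has no neighbour two spheres above it
  have far : ∀ {n} {w : (stage G T u (n + 1)).Cur} {x : (stage G T u n).Cur}
      {c : (stage G T u (n + 2)).Cur}, (stage G T u (n + 1)).D w x → (stage G T u (n + 2)).D c w →
      ¬ T ((stage G T u (n + 2)).fc c) ((stage G T u (n + 1)).fc w) ((stage G T u n).fc x) :=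
    fun hx hc hT => (free_of_mem hc).2 ((good_stage hG u (_ + 1)).covered hx hT)
  have hne := (hG.ne hT).2.2
  have mixed : ∀ {n} {w a : (stage G T u n).Cur} {c : (stage G T u (n + 1)).Cur},
      (stage G T u n).H w a → (stage G T u (n + 1)).D c w →
      T ((stage G T u (n + 1)).fc c) ((stage G T u n).fc w) ((stage G T u n).fc a) →
      (stage G T u (n + 1)).D c a := fun ha hc hT => (good_stage hG u _).mem_of hG hc ha hT
  cases h with
  | @horiz n a b h =>
    cases h' with
    | horiz h' => exact .horiz (((good_stage hG u _).fullHH h h' fun e => hne (by rw [e])).2 hT)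
    | up h' => exact .up (mixed h h' (hG.rotr hT))
    | down h' => exact .down (((good_stage hG u (_ + 1)).fullHD h h').2 hT)
  | @up n w c h =>
    cases h' with
    | horiz h' => exact .down (mixed h' h (hG.swapl hT))
    | up h' => exact .horiz ((Good.next_H_iff hG (good_stage hG u _) h h').2 hT)
    | down h' => exact (far h' h (hG.swapl hT)).elim
  | @down n w c h =>
    cases h' with
    | horiz h' => exact .up (((good_stage hG u (_ + 1)).fullHD h' h).2 (hG.swap hT))
    | up h' => exact (far h h' (hG.rotr hT)).elim
    | down h' => exact .horiz ((good_stage hG u _).pair hG h h' fun e => hne (by rw [e])).1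

/-- A triangle of the covering projects to a filled triangle. -/
theorem CAdj.filled (hG : LocallyLarge G T) {p q q' : Cover G T u} (h : CAdj p q) (h' : CAdj p q')
    (hq : CAdj q q') : T p.proj q.proj q'.proj := by
  have mixed : ∀ {n} {w a : (stage G T u n).Cur} {c : (stage G T u (n + 1)).Cur},
      (stage G T u n).H w a → (stage G T u (n + 1)).D c w → (stage G T u (n + 1)).D c a →
      T ((stage G T u (n + 1)).fc c) ((stage G T u n).fc w) ((stage G T u n).fc a) :=
    fun {n w a c} h hw ha => ((good_stage hG u n).pair hG hw ha fun e => by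
      subst e; exact (((good_stage hG u n).adjH h).ne rfl)).2
  cases h with
  | @horiz n a b h =>
    cases h' with
    | horiz h' =>
      cases hq with
      | horiz hq => exact ((good_stage hG u _).fullHH h h' fun e => by
          subst e; exact (((good_stage hG u n).adjH hq).ne rfl)).1 hq
    | up h' =>
      cases hq with
      | up hq => exact hG.rot (mixed h h' hq)
    | down h' =>
      cases hq with
      | down hq => exact ((good_stage hG u (_ + 1)).fullHD h h').1 hq
  | @up n w c h =>
    cases h' with
    | horiz h' =>
      cases hq with
      | down hq => exact hG.swapl (mixed h' h hq)
    | up h' =>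
      cases hq with
      | horiz hq => exact (Good.next_H_iff hG (good_stage hG u _) h h').1 hq
    | down h' => nomatch hq
  | @down n w c h =>
    cases h' with
    | horiz h' =>
      cases hq with
      | up hq => exact hG.swap (((good_stage hG u (_ + 1)).fullHD h' h).1 hq)
    | up h' => nomatch hq
    | down h' =>
      cases hq with
      | horiz hq => exact mixed hq h h'

end Cover

/-! ### Links of vertices and lifts of edge paths -/

/-- Three distinct vertices that lie in a common face. -/
def Filled (K : PreAbstractSimplicialComplex V) (a b c : V) : Prop :=
  a ≠ b ∧ a ≠ c ∧ b ≠ c ∧ ∃ σ ∈ K.faces, a ∈ σ ∧ b ∈ σ ∧ c ∈ σ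

theorem link_adj_iff {K : PreAbstractSimplicialComplex V} {x a b : V} :
    (oneSkeleton (link K x)).Adj a b ↔ Filled K x a b := by
  classical
  constructor
  · rintro ⟨hne, τ, ⟨-, hx, hτ⟩, ha, hb⟩
    exact ⟨fun h => hx (h ▸ ha), fun h => hx (h ▸ hb), hne, _, hτ, Finset.mem_cons_self _ _,
      Finset.mem_cons_of_mem ha, Finset.mem_cons_of_mem hb⟩
  · rintro ⟨hxa, hxb, hab, σ, hσ, hx, ha, hb⟩
    refine ⟨hab, σ.erase x, ⟨⟨a, by simp [ha, hxa.symm]⟩, by simp, ?_⟩, by simp [ha, hxa.symm],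
      by simp [hb, hxb.symm]⟩
    rwa [Finset.cons_eq_insert, Finset.insert_erase hx]

theorem false_of_cycle {W : Type*} {G : SimpleGraph W} {n : ℕ}
    (hG : IsEmpty (SimpleGraph.cycleGraph n ↪g G)) (f : Fin n → W) (hf : Function.Injective f)
    (h : ∀ i j, (SimpleGraph.cycleGraph n).Adj i j ↔ G.Adj (f i) (f j)) : False :=
  hG.false ⟨⟨f, hf⟩, fun {i j} => (h i j).symm⟩

theorem locallyLarge_of_link {K : PreAbstractSimplicialComplex V}
    (h : ∀ v, IsLarge 6 (link K v)) : LocallyLarge (oneSkeleton K) (Filled K) where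
  rot := fun ⟨h1, h2, h3, σ, hσ, ha, hb, hc⟩ => ⟨h3, h1.symm, h2.symm, σ, hσ, hb, hc, ha⟩
  swap := fun ⟨h1, h2, h3, σ, hσ, ha, hb, hc⟩ => ⟨h2, h1, h3.symm, σ, hσ, ha, hc, hb⟩
  adj := fun ⟨h1, _, _, σ, hσ, ha, hb, _⟩ => ⟨h1, σ, hσ, ha, hb⟩
  tetra := by
    classical
    intro a b c d hbc hbd hcd
    have hface : ({b, c, d} : Finset V) ∈ (link K a).faces := by
      refine (h a).1 _ ⟨b, by simp⟩ ?_
      obtain ⟨-, τ₁, h₁, hb₁, hc₁⟩ := link_adj_iff.2 hbc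
      obtain ⟨-, τ₂, h₂, hb₂, hd₂⟩ := link_adj_iff.2 hbd
      obtain ⟨-, τ₃, h₃, hc₃, hd₃⟩ := link_adj_iff.2 hcd
      simp only [Finset.mem_insert, Finset.mem_singleton]
      rintro v (rfl | rfl | rfl) w (rfl | rfl | rfl)
      exacts [⟨τ₁, h₁, hb₁, hb₁⟩, ⟨τ₁, h₁, hb₁, hc₁⟩, ⟨τ₂, h₂, hb₂, hd₂⟩, ⟨τ₁, h₁, hc₁, hb₁⟩,
        ⟨τ₁, h₁, hc₁, hc₁⟩, ⟨τ₃, h₃, hc₃, hd₃⟩, ⟨τ₂, h₂, hd₂, hb₂⟩, ⟨τ₃, h₃, hd₃, hc₃⟩,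
        ⟨τ₃, h₃, hd₃, hd₃⟩]
    obtain ⟨-, ha, hK⟩ := hface
    exact ⟨hbc.2.2.1, hbd.2.2.1, hcd.2.2.1, _, hK, by simp, by simp, by simp⟩
  quad := by
    intro x a b c d hab hbc hcd hda hac hbd
    simp only [← link_adj_iff] at *
    by_contra! hno
    obtain ⟨n1, n2⟩ := hno
    refine false_of_cycle ((h x).2 4 le_rfl (by norm_num)) ![a, b, c, d] ?_ ?_
    · have := hab.ne; have := hbc.ne; have := hcd.ne; have := hda.ne
      intro i j
      fin_cases i <;> fin_cases j <;> simp <;> grind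
    · have hirr := fun y => (oneSkeleton (link K x)).loopless.irrefl y
      have := hirr a; have := hirr b; have := hirr c; have := hirr d
      have := hab.symm; have := hbc.symm; have := hcd.symm; have := hda.symm
      have := mt SimpleGraph.Adj.symm n1; have := mt SimpleGraph.Adj.symm n2
      intro i j
      fin_cases i <;> fin_cases j <;>
        first
        | exact iff_of_true (by decide) (by assumption)
        | exact iff_of_false (by decide) (by assumption)
  pent := by
    intro x a b c d e hab hbc hcd hde hea hac hbd hce hda heb
    simp only [← link_adj_iff] at *
    by_contra! hno
    obtain ⟨n1, n2, n3, n4, n5⟩ := hno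
    refine false_of_cycle ((h x).2 5 (by norm_num) (by norm_num)) ![a, b, c, d, e] ?_ ?_
    · have := hab.ne; have := hbc.ne; have := hcd.ne; have := hde.ne; have := hea.ne
      intro i j
      fin_cases i <;> fin_cases j <;> simp <;> grind
    · have hirr := fun y => (oneSkeleton (link K x)).loopless.irrefl y
      have := hirr a; have := hirr b; have := hirr c; have := hirr d; have := hirr e
      have := hab.symm; have := hbc.symm; have := hcd.symm; have := hde.symm; have := hea.symm
      have := mt SimpleGraph.Adj.symm n1; have := mt SimpleGraph.Adj.symm n2
      have := mt SimpleGraph.Adj.symm n3; have := mt SimpleGraph.Adj.symm n4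
      have := mt SimpleGraph.Adj.symm n5
      intro i j
      fin_cases i <;> fin_cases j <;>
        first
        | exact iff_of_true (by decide) (by assumption)
        | exact iff_of_false (by decide) (by assumption)

namespace Cover

/-- The lift of the walk starting at `p` ends at `q`. -/
def Lift (p : Cover G T u) : ∀ {a b : V}, G.Walk a b → Cover G T u → Prop
  | _, _, .nil, q => p = q
  | _, _, .cons (v := v) _ w, q => ∃ p', CAdj p p' ∧ p'.proj = v ∧ Lift p' w q

theorem exists_lift {a b : V} (w : G.Walk a b) :
    ∀ p : Cover G T u, p.proj = a → ∃ q, Lift p w q := by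
  induction w with
  | nil => exact fun p _ => ⟨p, rfl⟩
  | cons h w ih =>
    intro p hp
    obtain ⟨p', hp', he⟩ := exists_cadj p (hp ▸ h)
    obtain ⟨q, hq⟩ := ih p' he
    exact ⟨q, p', hp', he, hq⟩

theorem Lift.proj {a b : V} {w : G.Walk a b} :
    ∀ {p q : Cover G T u}, p.proj = a → Lift p w q → q.proj = b := by
  induction w with
  | nil => rintro p q hp rfl; exact hp
  | cons h w ih => rintro p q hp ⟨p', -, he, hq⟩; exact ih he hq

theorem Lift.eq (hG : LocallyLarge G T) {a b : V} {w : G.Walk a b} :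
    ∀ {p q q' : Cover G T u}, Lift p w q → Lift p w q' → q = q' := by
  induction w with
  | nil => rintro p q q' rfl rfl; rfl
  | cons h w ih =>
    rintro p q q' ⟨p₁, h₁, e₁, hq⟩ ⟨p₂, h₂, e₂, hq'⟩
    obtain rfl := h₁.eq hG h₂ (e₁.trans e₂.symm)
    exact ih hq hq'

theorem lift_append {a b c : V} {w : G.Walk a b} {w' : G.Walk b c} :
    ∀ {p q : Cover G T u}, Lift p (w.append w') q ↔ ∃ x, Lift p w x ∧ Lift x w' q := by
  induction w with
  | nil => intro p q; simp [Lift]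
  | cons h w ih =>
    intro p q
    simp only [SimpleGraph.Walk.cons_append, Lift, ih]
    grind

theorem Lift.reverse (hG : LocallyLarge G T) {a b : V} {w : G.Walk a b} :
    ∀ {p q : Cover G T u}, p.proj = a → Lift p w q → Lift q w.reverse p := by
  induction w with
  | nil => rintro p q - rfl; rfl
  | cons h w ih =>
    rintro p q hp ⟨p', h', he, hq⟩
    rw [SimpleGraph.Walk.reverse_cons, lift_append]
    exact ⟨p', ih he hq, p, h'.symm hG, hp, rfl⟩

/-- Every vertex of the covering is the end of a lift which starts at the base vertex and goes up
at each step. -/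
theorem exists_lift_to (hG : LocallyLarge G T) : ∀ (n : ℕ) (c : (stage G T u n).Cur),
    ∃ w : G.Walk u (Cover.proj ⟨n, c⟩),
      w.length = n ∧ Lift (⟨0, PUnit.unit⟩ : Cover G T u) w ⟨n, c⟩
  | 0, c => ⟨.nil, rfl, rfl⟩
  | n + 1, c => by
    obtain ⟨x, hx⟩ := Layer.nonempty_class (G := G) (T := T) (L := stage G T u n) c
    obtain ⟨w, hw, hl⟩ := exists_lift_to hG n x
    have hup : CAdj (⟨n, x⟩ : Cover G T u) ⟨n + 1, c⟩ := .up hx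
    refine ⟨w.append (.cons (hup.adj hG) .nil), by simp [hw], ?_⟩
    exact lift_append.2 ⟨_, hl, _, hup, rfl, rfl⟩

/-- Homotopic walks have lifts with the same end. -/
theorem lift_congr {K : PreAbstractSimplicialComplex V}
    (hG : LocallyLarge (oneSkeleton K) (Filled K)) {a b : V} {w w' : (oneSkeleton K).Walk a b}
    (h : EdgeHomotopic K w w') : ∀ {p q : Cover (oneSkeleton K) (Filled K) u}, p.proj = a →
      (Lift p w q ↔ Lift p w' q) := by
  induction h with
  | refl => exact fun _ => Iff.rfl
  | symm _ ih => exact fun hp => (ih hp).symm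
  | trans _ _ ih ih' => exact fun hp => (ih hp).trans (ih' hp)
  | cons h _ ih =>
    intro p q hp
    simp only [Lift]
    exact exists_congr fun p' => and_congr_right fun _ => and_congr_right fun he => ih he
  | backtrack h h' w =>
    intro p q hp
    constructor
    · rintro ⟨p₁, h₁, e₁, p₂, h₂, e₂, hq⟩
      obtain rfl := h₂.eq hG (h₁.symm hG) (e₂.trans hp.symm)
      exact hq
    · intro hq
      obtain ⟨p₁, h₁, e₁⟩ := exists_cadj p (hp ▸ h)
      exact ⟨p₁, h₁, e₁, p, h₁.symm hG, hp, hq⟩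
  | @triangle a b c v σ hσ ha hb hc hab hbc hac w =>
    intro p q hp
    have hT : Filled K a b c := ⟨hab.1, hac.1, hbc.1, σ, hσ, ha, hb, hc⟩
    constructor
    · rintro ⟨p₁, h₁, e₁, p₂, h₂, e₂, hq⟩
      refine ⟨p₂, (h₁.symm hG).of_T hG h₂ ?_, e₂, hq⟩
      rw [e₁, hp, e₂]
      exact hG.swapl hT
    · rintro ⟨p₂, h₂, e₂, hq⟩
      obtain ⟨p₁, h₁, e₁⟩ := exists_cadj p (hp ▸ hab)
      refine ⟨p₁, h₁, e₁, p₂, h₁.of_T hG h₂ ?_, e₂, hq⟩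
      rwa [e₁, hp, e₂]

/-- Over a simply connected complex the covering projection is injective. -/
theorem proj_injective {K : PreAbstractSimplicialComplex V}
    (hG : LocallyLarge (oneSkeleton K) (Filled K))
    (hsc : ∀ (v : V) (p : (oneSkeleton K).Walk v v), EdgeHomotopic K p .nil) :
    Function.Injective (proj : Cover (oneSkeleton K) (Filled K) u → V) := by
  rintro ⟨n, a⟩ ⟨m, b⟩ he
  obtain ⟨w, -, hw⟩ := exists_lift_to hG n a
  obtain ⟨w', -, hw'⟩ := exists_lift_to hG m b
  have hu : Cover.proj (⟨0, PUnit.unit⟩ : Cover (oneSkeleton K) (Filled K) u) = u := rfl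
  obtain ⟨x, hx⟩ := exists_lift (w'.reverse.copy he.symm rfl) ⟨n, a⟩ rfl
  -- the closed walk that runs along `w` and back along `w'` lifts to a closed walk
  have hcl := (lift_congr hG (hsc u (w.append (w'.reverse.copy he.symm rfl))) hu).1
    (lift_append.2 ⟨_, hw, hx⟩)
  obtain rfl : _ = x := hcl
  have hback := hx.reverse hG rfl
  rw [SimpleGraph.Walk.reverse_copy, SimpleGraph.Walk.reverse_reverse] at hback
  have hcopy : ∀ {c d : V} (w : (oneSkeleton K).Walk u c) (h : c = d) {q},
      Lift (⟨0, PUnit.unit⟩ : Cover (oneSkeleton K) (Filled K) u) (w.copy rfl h) q →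
      Lift (⟨0, PUnit.unit⟩ : Cover (oneSkeleton K) (Filled K) u) w q := by
    rintro c d w rfl q h
    exact h
  exact (hcopy _ _ hback).eq hG hw'

end Cover

/-! ### Metric properties of systolic complexes -/

namespace Cover

theorem Lift.le {a b : V} {w : G.Walk a b} :
    ∀ {p q : Cover G T u}, Lift p w q → q.1 ≤ p.1 + w.length := by
  induction w with
  | nil => rintro p q rfl; simp
  | cons h w ih =>
    rintro p q ⟨p', h', -, hq⟩
    have h1 := ih hq
    have h2 := h'.le
    simp only [SimpleGraph.Walk.length_cons]
    omega

/-- Every vertex of a connected graph is the projection of a vertex of the covering whose level is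
the distance from the base vertex. -/
theorem exists_over (hG : LocallyLarge G T) (hc : G.Connected) (v : V) :
    ∃ p : Cover G T u, p.proj = v ∧ p.1 = G.dist u v := by
  obtain ⟨w, hw⟩ := hc.exists_walk_length_eq_dist u v
  obtain ⟨⟨n, c⟩, hq⟩ := exists_lift w (⟨0, PUnit.unit⟩ : Cover G T u) rfl
  have hp := Lift.proj (p := (⟨0, PUnit.unit⟩ : Cover G T u)) rfl hq
  have hle := hq.le
  obtain ⟨w', hw', -⟩ := exists_lift_to (u := u) hG n c
  have h' := SimpleGraph.dist_le w'
  rw [hw', hp] at h'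
  refine ⟨⟨n, c⟩, hp, ?_⟩
  simp only [zero_add] at hle
  dsimp only
  omega

end Cover

/-- Metric properties of the 1-skeleton of a systolic complex. Spheres satisfy the interval
condition (`inc`: the neighbours of a vertex that are closer to `u` are pairwise adjacent) and the
triangle condition (`tc`: an edge both of whose ends are at distance `k + 1` from `u` has a common
neighbour at distance `k`), and there is no full cycle of length 5 inside a vertex link. -/
structure Bridged (G : SimpleGraph V) : Prop where
  conn : G.Connected
  inc : ∀ {u y z z' : V} {k : ℕ}, G.dist u y = k + 1 → G.Adj y z → G.Adj y z' →
    G.dist u z = k → G.dist u z' = k → z = z' ∨ G.Adj z z'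
  tc : ∀ {u v w : V} {k : ℕ}, G.dist u v = k + 1 → G.dist u w = k + 1 → G.Adj v w →
    ∃ x, G.Adj v x ∧ G.Adj w x ∧ G.dist u x = k
  link : ∀ {x a b c d e : V}, G.Adj x a → G.Adj x b → G.Adj x c → G.Adj x d → G.Adj x e →
    G.Adj a b → G.Adj b c → G.Adj c d → G.Adj d e → G.Adj e a →
    a ≠ c → b ≠ d → c ≠ e → d ≠ a → e ≠ b →
    G.Adj a c ∨ G.Adj b d ∨ G.Adj c e ∨ G.Adj d a ∨ G.Adj e b

/-- The covering based at any vertex is the complex itself, and its spheres satisfy the required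
conditions by construction. -/
theorem IsSystolic.bridged {X : AbstractSimplicialComplex V} (hX : IsSystolic X) :
    Bridged (oneSkeleton X.toPreAbstractSimplicialComplex) := by
  set K := X.toPreAbstractSimplicialComplex
  have hG := locallyLarge_of_link hX.locally_large
  have hc := hX.connected
  have inj := fun u => Cover.proj_injective (u := u) hG hX.simplyConnected
  have level : ∀ {u} (p : Cover (oneSkeleton K) (Filled K) u),
      p.1 = (oneSkeleton K).dist u p.proj := by
    intro u p
    obtain ⟨q, hq, hd⟩ := Cover.exists_over (u := u) hG hc p.proj
    obtain rfl := inj u hq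
    exact hd
  have lift : ∀ {u} (p q : Cover (oneSkeleton K) (Filled K) u),
      (oneSkeleton K).Adj p.proj q.proj → Cover.CAdj p q := by
    intro u p q h
    obtain ⟨q', h', he⟩ := Cover.exists_cadj p h
    obtain rfl := inj u he
    exact h'
  have above := fun u v => Cover.exists_over (u := u) hG hc v
  have flag : ∀ {a b c}, (oneSkeleton K).Adj a b → (oneSkeleton K).Adj a c →
      (oneSkeleton K).Adj b c → Filled K a b c := by
    intro a b c hab hac hbc
    obtain ⟨p, hp, -⟩ := above a a
    obtain ⟨q, hq, -⟩ := above a b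
    obtain ⟨q', hq', -⟩ := above a c
    rw [← hp, ← hq] at hab
    rw [← hp, ← hq'] at hac
    rw [← hq, ← hq'] at hbc
    have h := (lift _ _ hab).filled hG (lift _ _ hac) (lift _ _ hbc)
    rwa [hp, hq, hq'] at h
  refine ⟨hc, ?_, ?_, ?_⟩
  · intro u y z z' k hy hyz hyz' hz hz'
    obtain ⟨⟨n, c⟩, rfl, -⟩ := above u y
    obtain ⟨⟨m, w⟩, rfl, -⟩ := above u z
    obtain ⟨⟨m', w'⟩, rfl, -⟩ := above u z'
    have h := lift _ _ hyz
    have h' := lift _ _ hyz'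
    obtain rfl : n = k + 1 := (level _).trans hy
    obtain rfl : m = k := (level _).trans hz
    obtain rfl : m' = m := (level _).trans hz'
    cases h with
    | down h =>
      cases h' with
      | down h' =>
        by_cases he : w = w'
        · subst he; exact Or.inl rfl
        · exact Or.inr ((good_stage hG u _).adjH ((good_stage hG u _).pair hG h h' he).1)
  · intro u v w k hv hw hvw
    obtain ⟨⟨n, c⟩, rfl, -⟩ := above u v
    obtain ⟨⟨m, c'⟩, rfl, -⟩ := above u w
    have h := lift _ _ hvw
    obtain rfl : n = k + 1 := (level _).trans hv
    obtain rfl : m = k + 1 := (level _).trans hw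
    cases h with
    | horiz h =>
      obtain ⟨x, hx, hx'⟩ := (good_stage hG u _).tri h
      exact ⟨Cover.proj (⟨_, x⟩ : Cover (oneSkeleton K) (Filled K) u),
        (Cover.CAdj.down hx).adj hG, (Cover.CAdj.down hx').adj hG, (level _).symm⟩
  · intro x a b c d e ha hb hc hd he hab hbc hcd hde hea h1 h2 h3 h4 h5
    have hT : ∀ {y z}, Filled K x y z → (oneSkeleton K).Adj y z := fun h => hG.adj (hG.rot h)
    exact (hG.pent (flag ha hb hab) (flag hb hc hbc) (flag hc hd hcd) (flag hd he hde)
      (flag he ha hea) h1 h2 h3 h4 h5).imp hT <| Or.imp hT <| Or.imp hT <| Or.imp hT hT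

/-! ### Short closed walks -/

/-- Two vertices at distance at most 1. -/
def Near (G : SimpleGraph V) (x y : V) : Prop := G.dist x y ≤ 1

theorem Near.symm {G : SimpleGraph V} {x y : V} (h : Near G x y) : Near G y x := by
  rwa [Near, SimpleGraph.dist_comm]

namespace Bridged

variable {G : SimpleGraph V}

theorem dist_le_one (hG : Bridged G) {x y : V} : G.dist x y ≤ 1 ↔ x = y ∨ G.Adj x y := by
  constructor
  · intro h
    rcases Nat.le_one_iff_eq_zero_or_eq_one.1 h with h | h
    · exact Or.inl (hG.conn.dist_eq_zero_iff.1 h)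
    · exact Or.inr (SimpleGraph.dist_eq_one_iff_adj.1 h)
  · rintro (rfl | h)
    · simp
    · exact (SimpleGraph.dist_eq_one_iff_adj.2 h).le

theorem tri (hG : Bridged G) (x y z : V) : G.dist x z ≤ G.dist x y + G.dist y z :=
  hG.conn.dist_triangle

theorem adj_of (hG : Bridged G) {x y : V} (h : G.dist x y ≤ 1) (hne : x ≠ y) : G.Adj x y :=
  (hG.dist_le_one.1 h).resolve_left hne

theorem inc' (hG : Bridged G) {u y z z' : V} {k : ℕ} (hy : G.dist u y = k + 1)
    (h : G.dist y z ≤ 1) (h' : G.dist y z' ≤ 1) (hz : G.dist u z ≤ k) (hz' : G.dist u z' ≤ k) :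
    G.dist z z' ≤ 1 := by
  have h1 := hG.tri u z y
  have h2 := hG.tri u z' y
  rw [G.dist_comm (u := z)] at h1
  rw [G.dist_comm (u := z')] at h2
  exact hG.dist_le_one.2 (hG.inc hy (hG.adj_of h (by rintro rfl; omega))
    (hG.adj_of h' (by rintro rfl; omega)) (by omega) (by omega))

theorem tc' (hG : Bridged G) {u v w : V} {k : ℕ} (hv : G.dist u v = k + 1)
    (hw : G.dist u w = k + 1) (h : G.dist v w ≤ 1) (hne : v ≠ w) :
    ∃ x, G.dist v x ≤ 1 ∧ G.dist w x ≤ 1 ∧ G.dist u x = k := by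
  obtain ⟨x, h1, h2, h3⟩ := hG.tc hv hw (hG.adj_of h hne)
  exact ⟨x, hG.dist_le_one.2 (Or.inr h1), hG.dist_le_one.2 (Or.inr h2), h3⟩

/-- A closed walk of length 4 has a diagonal of length at most 1. -/
theorem quad (hG : Bridged G) {x y z w : V} (hxy : Near G x y) (hyz : Near G y z)
    (hzw : Near G z w) (hwx : Near G w x) : Near G x z ∨ Near G y w := by
  unfold Near at *
  by_cases h : G.dist x z ≤ 1
  · exact Or.inl h
  have h1 := hG.tri x y z
  rw [G.dist_comm] at hyz hwx
  exact Or.inr (hG.inc' (u := x) (y := z) (k := 1) (by rw [G.dist_comm (u := z)] at hyz; omega)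
    hyz hzw hxy hwx)

/-- In a closed walk of length 5, the two neighbours of a vertex that has no diagonal are at
distance at most 1. -/
theorem ear (hG : Bridged G) {x₀ x₁ x₂ x₃ x₄ : V} (h01 : Near G x₀ x₁)
    (h12 : Near G x₁ x₂) (h23 : Near G x₂ x₃) (h34 : Near G x₃ x₄)
    (h40 : Near G x₄ x₀) (h02 : ¬ Near G x₀ x₂) (h03 : ¬ Near G x₀ x₃) :
    Near G x₁ x₄ := by
  unfold Near at *
  have hc : ∀ {x y}, G.dist x y ≤ 1 → G.dist y x ≤ 1 := fun {x y} h => by rwa [G.dist_comm]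
  have q13 : G.dist x₁ x₃ ≤ 1 → G.dist x₁ x₄ ≤ 1 := fun h =>
    (hG.quad h01 h h34 h40).resolve_left h03
  have q24 : G.dist x₂ x₄ ≤ 1 → G.dist x₁ x₄ ≤ 1 := fun h =>
    (hG.quad h01 h12 h h40).resolve_left h02
  by_contra hno
  have e02 : G.dist x₀ x₂ = 1 + 1 := by have := hG.tri x₀ x₁ x₂; omega
  have e03 : G.dist x₀ x₃ = 1 + 1 := by
    have := hG.tri x₀ x₄ x₃; have := hc h34; have := hc h40; omega
  have n23 : x₂ ≠ x₃ := by rintro rfl; exact hno (q24 h34)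
  obtain ⟨p, h2p, h3p, h0p⟩ := hG.tc' e02 e03 h23 n23
  have h1p := hG.inc' e02 (hc h12) h2p h01 h0p.le
  have h4p := hG.inc' e03 h34 h3p (hc h40) h0p.le
  have ne : ∀ {x y}, ¬ G.dist x y ≤ 1 → x ≠ y := fun h e => h (hG.dist_le_one.2 (Or.inl e))
  have n13 := ne fun h => hno (q13 h)
  have n24 := ne fun h => hno (q24 h)
  have n01 : x₀ ≠ x₁ := by rintro rfl; exact h02 h12
  have n12 : x₁ ≠ x₂ := by rintro rfl; exact h02 h01
  have n34 : x₃ ≠ x₄ := by rintro rfl; exact h03 (hc h40)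
  have n40 : x₄ ≠ x₀ := by rintro rfl; exact h03 (hc h34)
  have p0 : p ≠ x₀ := by rintro rfl; exact h02 (hc h2p)
  have p1 : p ≠ x₁ := by rintro rfl; exact hno (q13 (hc h3p))
  have p2 : p ≠ x₂ := by rintro rfl; exact h02 h0p.le
  have p3 : p ≠ x₃ := by rintro rfl; exact h03 h0p.le
  have p4 : p ≠ x₄ := by rintro rfl; exact hno (q24 h2p)
  have cl : ∀ {x y}, G.Adj x y → G.dist x y ≤ 1 := fun h => hG.dist_le_one.2 (Or.inr h)
  rcases hG.link (hG.adj_of (hc h0p.le) p0) (hG.adj_of (hc h1p) p1) (hG.adj_of (hc h2p) p2)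
    (hG.adj_of (hc h3p) p3) (hG.adj_of (hc h4p) p4) (hG.adj_of h01 n01) (hG.adj_of h12 n12)
    (hG.adj_of h23 n23) (hG.adj_of h34 n34) (hG.adj_of h40 n40) (ne h02) n13 n24 (ne h03).symm
    (ne hno).symm with h | h | h | h | h
  · exact h02 (cl h)
  · exact hno (q13 (cl h))
  · exact hno (q24 (cl h))
  · exact h03 (hc (cl h))
  · exact hno (hc (cl h))

end Bridged

/-! ### Configurations of two stable cliques -/

/-- Three isometric involutions `R`, `S`, `T` of a graph, of which `R` and `T` commute, and two
cliques `A` and `B` that are stable under `S`, `T` and under `R`, `S`. The exchange of `A` with `B`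
and of `R` with `T` is a symmetry of this structure. -/
structure Config (G : SimpleGraph V) (R S T : V → V) (A B : Set V) : Prop where
  rr : ∀ x, R (R x) = x
  ss : ∀ x, S (S x) = x
  tt : ∀ x, T (T x) = x
  comm : ∀ x, R (T x) = T (R x)
  distR : ∀ x y, G.dist (R x) (R y) = G.dist x y
  distS : ∀ x y, G.dist (S x) (S y) = G.dist x y
  distT : ∀ x y, G.dist (T x) (T y) = G.dist x y
  memAS : ∀ {x}, x ∈ A → S x ∈ A
  memAT : ∀ {x}, x ∈ A → T x ∈ A
  memBS : ∀ {x}, x ∈ B → S x ∈ B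
  memBR : ∀ {x}, x ∈ B → R x ∈ B
  nearA : ∀ {x y}, x ∈ A → y ∈ A → Near G x y
  nearB : ∀ {x y}, x ∈ B → y ∈ B → Near G x y

/-- The local criterion for the existence of intersecting stable cliques: the orbit of `b` under
`S` and `T`, the orbit of `a` under `R` and `S`, or both orbits of `c` will be cliques. -/
def Meets (G : SimpleGraph V) (R S T : V → V) (A B : Set V) : Prop :=
  (∃ b ∈ B, Near G (S b) (T b)) ∨ (∃ a ∈ A, Near G (S a) (R a)) ∨
    ∃ c, Near G c (S c) ∧ Near G (S c) (T c) ∧ Near G (S c) (R c)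

namespace Config

variable {G : SimpleGraph V} {R S T : V → V} {A B : Set V}

theorem swap (c : Config G R S T A B) : Config G T S R B A where
  rr := c.tt
  ss := c.ss
  tt := c.rr
  comm := fun x => (c.comm x).symm
  distR := c.distT
  distS := c.distS
  distT := c.distR
  memAS := c.memBS
  memAT := c.memBR
  memBS := c.memAS
  memBR := c.memAT
  nearA := c.nearB
  nearB := c.nearA

theorem meets_of_swap (h : Meets G T S R B A) : Meets G R S T A B := by
  rcases h with h | h | ⟨x, h1, h2, h3⟩
  exacts [Or.inr (Or.inl h), Or.inl h, Or.inr (Or.inr ⟨x, h1, h3, h2⟩)]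

theorem mR (c : Config G R S T A B) {x y : V} (h : Near G x y) : Near G (R x) (R y) := by
  rwa [Near, c.distR]

theorem mS (c : Config G R S T A B) {x y : V} (h : Near G x y) : Near G (S x) (S y) := by
  rwa [Near, c.distS]

theorem mT (c : Config G R S T A B) {x y : V} (h : Near G x y) : Near G (T x) (T y) := by
  rwa [Near, c.distT]

theorem iR (c : Config G R S T A B) {x y : V} : Near G (R x) y ↔ Near G x (R y) :=
  ⟨fun h => by simpa [c.rr] using c.mR h, fun h => by simpa [c.rr] using c.mR h⟩

theorem iS (c : Config G R S T A B) {x y : V} : Near G (S x) y ↔ Near G x (S y) :=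
  ⟨fun h => by simpa [c.ss] using c.mS h, fun h => by simpa [c.ss] using c.mS h⟩

theorem iT (c : Config G R S T A B) {x y : V} : Near G (T x) y ↔ Near G x (T y) :=
  ⟨fun h => by simpa [c.tt] using c.mT h, fun h => by simpa [c.tt] using c.mT h⟩

variable {a b : V}

/-- The neighbours in `B` of a vertex of `A` form an `S`-stable set. -/
theorem near_S (c : Config G R S T A B) (hG : Bridged G) (ha : a ∈ A) (hb : b ∈ B)
    (h : Near G a b) : Near G a (S b) := by
  rcases hG.quad h (c.nearB hb (c.memBS hb)) (c.mS h.symm) (c.nearA (c.memAS ha) ha) with h | h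
  · exact h
  · exact c.iS.1 h.symm

/-- If `b` is near `T b`, then the neighbours of `b` in `A` form a `T`-stable set. -/
theorem near_T (c : Config G R S T A B) (hG : Bridged G) (ha : a ∈ A)
    (hbT : Near G b (T b)) (h : Near G a b) : Near G a (T b) := by
  rcases hG.quad h hbT (c.mT h.symm) (c.nearA (c.memAT ha) ha) with h | h
  · exact h
  · exact c.iT.1 h.symm

/-- If `b` is near `T b`, then closed walks of length 4 and 5 first show that `a` is near `R a`. Then
`S a`, `T b`, `R a`, `S b` is a closed walk of length 4, each of whose diagonals settles the matter. -/
theorem meets_of_near_T (c : Config G R S T A B) (hG : Bridged G) (ha : a ∈ A) (hb : b ∈ B)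
    (hab : Near G a b) (hbT : Near G b (T b)) : Meets G R S T A B := by
  by_contra hno
  have nb : ∀ b ∈ B, ¬ Near G (S b) (T b) := fun b hb h => hno (Or.inl ⟨b, hb, h⟩)
  have na : ∀ a ∈ A, ¬ Near G (S a) (R a) := fun a ha h => hno (Or.inr (Or.inl ⟨a, ha, h⟩))
  have hbR : Near G b (R b) := c.nearB hb (c.memBR hb)
  have hTR : Near G (T b) (R b) := by
    rcases hG.quad hbT (c.mT hbR) (by rw [← c.comm]; exact c.mR hbT.symm) hbR.symm with h | h
    · exact c.iT.2 h
    · exact h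
  have key : ∀ a ∈ A, Near G a b → Near G a (R b) := fun a ha h => by
    rcases hG.quad hTR (c.nearB (c.memBR hb) (c.memBS hb)) (c.near_S hG ha hb h).symm
      (c.near_T hG ha hbT h) with h' | h'
    · exact (nb b hb h'.symm).elim
    · exact h'.symm
  have hRT : Near G (R a) (T b) := c.iR.2 <| by
    have := key _ (c.memAT ha) (c.iT.2 (c.near_T hG ha hbT hab))
    rw [c.comm]
    exact c.iT.1 this
  have hSb := c.near_S hG ha hb hab
  have hSR := c.nearB (c.memBS hb) (c.memBR (c.memBS hb))
  -- `T b` has no diagonal in the cycle `T b`, `a`, `S b`, `R (S b)`, `R a`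
  have haR : Near G a (R a) := by
    refine hG.ear (c.near_T hG ha hbT hab).symm hSb hSR (c.mR hSb.symm) hRT
      (fun h => nb b hb (Near.symm h)) fun h => ?_
    have h : Near G (T b) (R (S b)) := h
    rcases hG.quad hSR h.symm (by rw [c.comm]; exact c.mT hbR) (c.iR.2 h) with h | h
    · exact nb b hb h
    · exact nb b hb (by simpa [c.rr] using c.mR h)
  have h1 : Near G (S a) (T b) := c.near_T hG (c.memAS ha) hbT (c.iS.2 hSb)
  have h2 : Near G (R a) (S b) := (c.swap.near_T hG (c.memBS hb) haR hSb.symm).symm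
  rcases hG.quad h1 hRT.symm h2 (c.mS hab.symm) with h | h
  · exact na a ha h
  · exact nb b hb (Near.symm h)

end Config

theorem Bridged.exists_mid {G : SimpleGraph V} (hG : Bridged G) {x z : V} (h : G.dist x z ≤ 2) :
    ∃ y, Near G x y ∧ Near G y z := by
  obtain ⟨w, hw⟩ := hG.conn.exists_walk_length_eq_dist x z
  cases w with
  | nil => exact ⟨x, by simp [Near], by simp [Near]⟩
  | @cons _ y _ hxy w =>
    refine ⟨y, hG.dist_le_one.2 (Or.inr hxy), (SimpleGraph.dist_le w).trans ?_⟩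
    simp only [SimpleGraph.Walk.length_cons] at hw
    omega

/-- The vertex `x` is near the four images of `v` under the group generated by `R` and `T`. -/
def Around (G : SimpleGraph V) (R T : V → V) (v x : V) : Prop :=
  Near G x v ∧ Near G x (R v) ∧ Near G x (T v) ∧ Near G x (R (T v))

namespace Config

variable {G : SimpleGraph V} {R S T : V → V} {A B : Set V} {a b x : V}

theorem meets_of_near_R (c : Config G R S T A B) (hG : Bridged G) (ha : a ∈ A) (hb : b ∈ B)
    (hab : Near G a b) (haR : Near G a (R a)) : Meets G R S T A B :=
  meets_of_swap (c.swap.meets_of_near_T hG hb ha hab.symm haR)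

/-- If `a` is near both `R b` and `T b`, then one of the diagonals of the walk `a`, `T b`, `R (T a)`,
`R b` makes `a`, `b`, `R a`, `T b` a closed walk of length 4. -/
theorem meets_of_both (c : Config G R S T A B) (hG : Bridged G) (ha : a ∈ A) (hb : b ∈ B)
    (hab : Near G a b) (haT : Near G a (T b)) (haR : Near G a (R b)) : Meets G R S T A B := by
  by_contra hno
  have naR : ¬ Near G a (R a) := fun h => hno (c.meets_of_near_R hG ha hb hab h)
  have nbT : ¬ Near G b (T b) := fun h => hno (c.meets_of_near_T hG ha hb hab h)
  have hbRa : Near G b (R a) := (c.iR.2 haR).symm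
  have final : ¬ Near G (R a) (T b) := fun h =>
    (hG.quad hab hbRa h haT.symm).elim naR nbT
  have h1 : Near G (T b) (R (T a)) := by
    rw [c.comm]
    exact c.mT hbRa
  have h2 : Near G (R (T a)) (R b) := c.mR (c.iT.2 haT)
  rcases hG.quad haT h1 h2 haR.symm with h | h
  · rcases hG.quad h (c.mR (c.nearA (c.memAT ha) ha)) hbRa.symm hab.symm with h | h
    · exact naR h
    · rw [c.comm] at h
      exact final (c.iT.1 h)
  · have h : Near G b (R (T b)) := by
      rw [c.comm]
      exact c.iT.1 h
    have h3 : Near G (R (T b)) (T b) := by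
      rw [c.comm]
      exact c.mT (c.nearB (c.memBR hb) hb)
    rcases hG.quad h h3 haT.symm hab with h | h
    · exact nbT h
    · exact final (c.iR.2 h.symm)

theorem around_R (c : Config G R S T A B) (h : Around G R T a x) : Around G R T a (R x) := by
  obtain ⟨h1, h2, h3, h4⟩ := h
  exact ⟨c.iR.2 h2, c.mR h1, c.iR.2 h4, c.mR h3⟩

theorem around_T (c : Config G R S T A B) (h : Around G R T a x) : Around G R T a (T x) := by
  obtain ⟨h1, h2, h3, h4⟩ := h
  rw [c.comm] at h4
  refine ⟨c.iT.2 h3, c.iT.2 h4, c.mT h1, ?_⟩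
  rw [c.comm]
  exact c.mT h2

theorem around_swap (c : Config G R S T A B) (h : Around G T R a x) : Around G R T a x := by
  obtain ⟨h1, h2, h3, h4⟩ := h
  rw [← c.comm] at h4
  exact ⟨h1, h3, h2, h4⟩

/-- A vertex `x` that is near the images of `a` and `b` under `R` and `T` is near `S x`, `S (R x)`
and `S (T x)`, by two cycles of length 5. -/
theorem meets_of_around (c : Config G R S T A B) (hG : Bridged G) (ha : a ∈ A) (hb : b ∈ B)
    (hab : Near G a b) (nbT : ¬ Near G b (T b)) (naR : ¬ Near G a (R b))
    (hxa : Around G R T a x) (hxb : Around G R T b x) : Meets G R S T A B := by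
  have hRb := c.memBR hb
  have near_Sa : ∀ {x}, Around G R T a x → Around G R T b x → Near G x (S a) := by
    rintro x - ⟨h1, -, h3, -⟩
    have hbS := c.iS.2 (c.near_S hG ha hb hab)
    by_cases h : Near G (S a) (T b)
    · exact (hG.quad h1 hbS.symm h h3.symm).resolve_right nbT
    · exact hG.ear h1.symm h3 (c.mT hbS.symm)
        (c.nearA (c.memAT (c.memAS ha)) (c.memAS ha)) hbS nbT
        fun h' => h (c.iT.1 h'.symm)
  have pair : ∀ {x y}, Around G R T a x → Around G R T b x → Around G R T a y →
      Around G R T b y → Near G x (S y) := fun {x y} hxa hxb hya hyb =>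
    hG.ear hxa.1.symm hxb.2.1 (c.nearB hRb (c.memBS hRb)) (c.mS hyb.2.1.symm)
      (c.iS.2 (near_Sa hya hyb)) naR fun h => naR (by
        simpa [c.ss] using c.near_S hG ha (c.memBS hRb) h)
  exact Or.inr (Or.inr ⟨x, pair hxa hxb hxa hxb,
    (pair (c.around_T hxa) (c.around_T hxb) hxa hxb).symm,
    (pair (c.around_R hxa) (c.around_R hxb) hxa hxb).symm⟩)

/-- A common neighbour of `a` and `R a` is a neighbour of `b` and `R b`. -/
theorem near_of_mid (c : Config G R S T A B) (hG : Bridged G) (hbR : Near G b (R b))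
    (hab : Near G a b) (naR : ¬ Near G a (R a)) (naRb : ¬ Near G a (R b)) (h : Near G x a)
    (h' : Near G x (R a)) : Near G x b ∧ Near G x (R b) :=
  ⟨(hG.ear hab hbR (c.mR hab.symm) h'.symm h naRb naR).symm,
    (hG.ear (c.mR hab) hbR.symm hab.symm h.symm h' (fun e => naRb (c.iR.1 e))
      fun e => naR e.symm).symm⟩

/-- A common neighbour of `a` and `R a` yields one that is also a neighbour of `T a` and
`R (T a)`. -/
theorem exists_around_of_mid (c : Config G R S T A B) (hG : Bridged G)
    (haT : Near G a (T a)) (naR : ¬ Near G a (R a)) (naRT : ¬ Near G a (R (T a)))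
    (h : Near G x a) (h' : Near G x (R a)) : ∃ y, Around G R T a y := by
  have naTR : ¬ Near G (T a) (R (T a)) := fun e => naR (by
    rw [c.comm] at e
    simpa [c.tt] using c.mT e)
  have naT' : ¬ Near G (T a) (R a) := fun e => naRT (by
    rw [c.comm]
    exact c.iT.1 e)
  have hRT : Near G (R a) (R (T a)) := c.mR haT
  have hTx : Near G (T x) (T a) := c.mT h
  have hTx' : Near G (T x) (R (T a)) := by
    rw [c.comm]
    exact c.mT h'
  have near_self : Near G x (T x) → ∃ y, Around G R T a y := by
    intro hx
    refine ⟨x, h, h', ?_, ?_⟩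
    · rcases hG.quad hx hTx haT.symm h.symm with e | e
      · exact e
      · exact c.iT.1 e
    · rcases hG.quad hx hTx' hRT.symm h'.symm with e | e
      · exact e
      · rw [c.comm]
        exact c.iT.1 e
  by_cases h1 : Near G x (T a)
  · exact near_self (hG.ear h1.symm h' hRT hTx'.symm hTx naT' naTR)
  by_cases h2 : Near G x (R (T a))
  · exact near_self (hG.ear h2.symm h haT hTx.symm hTx' (fun e => naRT e.symm)
      fun e => naTR e.symm)
  by_cases h3 : Near G x (T x)
  · exact near_self h3
  have t1 := hG.tri x a (T a)
  have t2 := hG.tri x (R a) (R (T a))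
  have t3 := hG.tri x (T a) (T x)
  have hd : G.dist x (T x) ≤ 2 := by
    by_contra hd
    have hTx2 := hTx.symm
    unfold Near at h h' haT hRT hTx2 naTR
    exact naTR (hG.inc' (u := x) (y := T x) (k := 2) (by omega) hTx hTx' (by omega) (by omega))
  obtain ⟨w, hw, hw'⟩ := hG.exists_mid hd
  refine ⟨w, ?_, ?_, ?_, ?_⟩
  · exact (hG.ear h haT hTx.symm hw'.symm hw.symm h1 h3).symm
  · exact (hG.ear h' hRT hTx'.symm hw'.symm hw.symm h2 h3).symm
  · exact (hG.ear hTx haT.symm h.symm hw hw' (fun e => h1 (c.iT.1 e))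
      fun e => h3 e.symm).symm
  · exact (hG.ear hTx' hRT.symm h'.symm hw hw' (fun e => h2 (by
      rw [c.comm]; exact c.iT.1 e)) fun e => h3 e.symm).symm

end Config

/-! ### Existence of a common centre -/

namespace Config

variable {G : SimpleGraph V} {R S T : V → V} {A B : Set V} {a b : V}

/-- If `a` and `b` are adjacent, the distances from `a` to `R a` and from `b` to `T b` are not both
3. The triangle condition gives an edge `z y` that cuts off the edge between `T b` and `R (T b)`,
and the interval condition at `y` then brings `z` too close to `R b`. -/
theorem false_of_no_mid (c : Config G R S T A B) (hG : Bridged G) (hb : b ∈ B)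
    (hab : Near G a b) (haT : Near G a (T a)) (naRb : ¬ Near G a (R b))
    (na : ¬ ∃ x, Near G x a ∧ Near G x (R a))
    (nb : ¬ ∃ x, Near G x b ∧ Near G x (T b)) : False := by
  have hbR : Near G b (R b) := c.nearB hb (c.memBR hb)
  have hTb : Near G (T b) (R (T b)) := by
    rw [c.comm]
    exact c.mT hbR
  have hTab : Near G (T a) (T b) := c.mT hab
  have hRT : Near G (R (T a)) (R (T b)) := c.mR hTab
  have hRa : Near G (R a) (R (T a)) := c.mR haT
  have hRab : Near G (R a) (R b) := c.mR hab
  have dc : ∀ x y, G.dist x y = G.dist y x := fun x y => G.dist_comm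
  -- distances from `b`
  have dTa : G.dist b (T a) ≤ 2 := by
    have := hG.tri b a (T a)
    have := dc b a
    unfold Near at *
    omega
  have dTb : G.dist b (T b) = 2 + 1 := by
    have h1 := hG.tri b (T a) (T b)
    have h2 : ¬ G.dist b (T b) ≤ 2 := fun h => by
      obtain ⟨y, hy, hy'⟩ := hG.exists_mid h
      exact nb ⟨y, hy.symm, hy'⟩
    unfold Near at *
    omega
  have dRTa : G.dist b (R (T a)) ≤ 3 := by
    have := hG.tri b (R b) (R (T a))
    have := hG.tri (R b) (R a) (R (T a))
    have := dc (R b) (R a)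
    unfold Near at *
    omega
  have dRTb : G.dist b (R (T b)) = 2 + 1 := by
    have h1 := hG.tri b (T b) (R (T b))
    have h2 : ¬ G.dist b (R (T b)) ≤ 2 := fun h => by
      have := hG.inc' dTb hTb hTab.symm h dTa
      exact naRb (by simpa [c.comm, c.tt] using (c.mT (Near.symm this)))
    have h3 : G.dist b (R (T b)) ≠ 3 + 1 := fun h => by
      have := hG.inc' h hTb.symm hRT.symm dTb.le dRTa
      rw [c.comm] at this
      exact naRb (c.iR.1 (Near.symm (by simpa [c.tt] using c.mT this)))
    unfold Near at *
    omega
  -- distances from `R b`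
  have dRTb' : G.dist (R b) (R (T b)) = 2 + 1 := by rw [c.distR, dTb]
  have dTb' : G.dist (R b) (T b) = 2 + 1 := by rw [← c.distR, c.rr, dRTb]
  have dRTa' : G.dist (R b) (R (T a)) ≤ 2 := by rwa [c.distR]
  -- a vertex near `T a` and `R (T a)` is the image of one near `a` and `R a`
  have noT : ∀ {x}, Near G x (T a) → ¬ Near G x (R (T a)) := fun {x} h h' => by
    rw [c.comm] at h'
    exact na ⟨T x, c.iT.2 h, c.iT.2 h'⟩
  have hne : T b ≠ R (T b) := fun e => by
    have : b = R b := by simpa [c.comm, c.tt] using congrArg T e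
    exact naRb (this ▸ hab)
  -- the edge between `T b` and `R (T b)` is seen from `b`, and then from `R b`
  obtain ⟨z, hz, hz', dz⟩ := hG.tc' dTb dRTb hTb hne
  have hzT : Near G z (T a) := hG.inc' dTb hz hTab.symm dz.le dTa
  have dz' : G.dist (R b) z = 2 + 1 := by
    have h1 := hG.tri (R b) b z
    have h2 : ¬ G.dist (R b) z ≤ 2 := fun h =>
      noT hzT (hG.inc' dRTb' hz' hRT.symm h dRTa')
    have := dc (R b) b
    unfold Near at *
    omega
  have hRz : Near G (R z) (T b) := c.iR.2 (Near.symm hz')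
  have hRz' : Near G (R z) (R (T b)) := c.mR (Near.symm hz)
  have dRz : G.dist (R b) (R z) ≤ 2 := by rw [c.distR, dz]
  have hney : z ≠ R (T b) := by
    rintro rfl
    omega
  obtain ⟨y, hzy, hyT, hyR, dy⟩ : ∃ y, Near G z y ∧ Near G (T b) y ∧ Near G y (R (T a)) ∧
      G.dist (R b) y ≤ 2 := by
    obtain ⟨y, hzy, hy, dy⟩ := hG.tc' dz' dRTb' (Near.symm hz') hney
    have hyz : Near G y (R z) := hG.inc' dRTb' hy hRz'.symm dy.le dRz
    have hyR : Near G y (R (T a)) := hG.inc' dRTb' hy hRT.symm dy.le dRTa'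
    rcases hG.quad (Near.symm hzy) (Near.symm hz) hRz.symm hyz.symm with h | h
    · exact ⟨y, hzy, h.symm, hyR, dy.le⟩
    · exact ⟨R z, h, hRz.symm, c.mR hzT, dRz⟩
  have dy' : G.dist b y = 2 + 1 := by
    have h1 := hG.tri b z y
    have h2 : ¬ G.dist b y ≤ 2 := fun h => noT (hG.inc' dTb hyT hTab.symm h dTa) hyR
    unfold Near at *
    omega
  obtain ⟨v, hv, hv'⟩ := hG.exists_mid dy
  have dv : G.dist b v ≤ 2 := by
    have := hG.tri b (R b) v
    unfold Near at *
    omega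
  have hzv : Near G z v := hG.inc' dy' hzy.symm hv'.symm dz.le dv
  have := hG.tri (R b) v z
  have := dc v z
  unfold Near at *
  omega

/-- The alternative in which `a` is not near `R b`: there is a vertex near all images of `a` and
`b` under `R` and `T`. -/
theorem meets_of_not_near (c : Config G R S T A B) (hG : Bridged G) (ha : a ∈ A) (hb : b ∈ B)
    (hab : Near G a b) (naRb : ¬ Near G a (R b)) : Meets G R S T A B := by
  by_contra hno
  have naR : ¬ Near G a (R a) := fun h => hno (c.meets_of_near_R hG ha hb hab h)
  have nbT : ¬ Near G b (T b) := fun h => hno (c.meets_of_near_T hG ha hb hab h)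
  have haT : Near G a (T a) := c.nearA ha (c.memAT ha)
  have hbR : Near G b (R b) := c.nearB hb (c.memBR hb)
  have hTb : Near G (T b) (R (T b)) := by
    rw [c.comm]
    exact c.mT hbR
  have hTab : Near G (T a) (T b) := c.mT hab
  have hRT : Near G (R (T a)) (R (T b)) := c.mR hTab
  have hRa : Near G (R a) (R (T a)) := c.mR haT
  -- the further diagonals between images of `a` and `b` that are excluded
  have naRT : ¬ Near G a (R (T b)) := fun h => by
    by_cases h' : Near G a (T b)
    · refine hno (c.meets_of_both hG (c.memAT ha) hb (c.iT.2 h') (c.mT hab) ?_)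
      rw [c.comm] at h
      exact c.iT.2 h
    · rcases hG.quad h hTb.symm hTab.symm haT.symm with e | e
      · exact h' e
      · rw [c.comm] at e
        exact naRb (by simpa [c.tt] using c.mT e.symm)
  have nRTb : ¬ Near G b (R (T b)) := fun h => by
    by_cases h' : Near G a (T b)
    · rcases hG.quad hbR (c.mR hab.symm) (c.mR h') h.symm with e | e
      · exact naRb (c.iR.1 e.symm)
      · exact nbT (by simpa [c.rr] using c.mR e)
    · exact h' (c.iT.1 (hG.ear hab h hTb.symm hTab.symm haT.symm naRT h').symm)
  have naRTa : ¬ Near G a (R (T a)) := fun h => naRb <|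
    hG.ear hab.symm h hRa.symm (c.mR hab) hbR.symm
      (fun e => naRT (Near.symm (by
        rw [c.comm]
        exact c.iT.2 (c.iR.2 e)))) fun e => naRb (c.iR.1 e.symm)
  by_cases haTb : Near G a (T b)
  · obtain ⟨x, hx, hx'⟩ : ∃ x, Near G a x ∧ Near G x (R a) := by
      refine hG.exists_mid ?_
      by_contra hd
      have t1 := hG.tri a b (R b)
      have t2 := hG.tri a (T b) (R (T b))
      have t3 := hG.tri a (R b) (R a)
      have hba : Near G (R b) (R a) := c.mR hab.symm
      have := hG.inc' (u := a) (y := R a) (k := 2) (by unfold Near at *; omega) (c.mR hab)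
        (c.mR haTb) (by unfold Near at *; omega) (by unfold Near at *; omega)
      exact nbT (by simpa [c.rr] using c.mR this)
    obtain ⟨h1, h2⟩ := c.near_of_mid hG hbR hab naR naRb hx.symm hx'
    obtain ⟨h3, h4⟩ := c.near_of_mid hG hTb haTb naR naRT hx.symm hx'
    have h5 : Near G x (T a) :=
      (hG.quad h1 (c.iT.2 haTb).symm hTab h3.symm).resolve_right nbT
    have h6 : Near G x (R (T a)) :=
      (hG.quad h2 (c.mR (c.iT.2 haTb).symm) hRT h4.symm).resolve_right
        fun e => nbT (by simpa [c.rr] using c.mR e)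
    exact hno (c.meets_of_around hG ha hb hab nbT naRb ⟨hx.symm, hx', h5, h6⟩ ⟨h1, h2, h3, h4⟩)
  · have nbTa : ¬ Near G b (T a) := fun e => haTb (c.iT.1 e.symm)
    have around : ∀ {x}, Around G R T a x → Around G R T b x := fun {x} h => by
      obtain ⟨h1, h2⟩ := c.near_of_mid hG hbR hab naR naRb h.1 h.2.1
      obtain ⟨h3, h4⟩ := c.near_of_mid hG hTb hTab
        (fun e => naR (by rw [c.comm] at e; simpa [c.tt] using c.mT e))
        (fun e => naRb (by rw [c.comm] at e; simpa [c.tt] using c.mT e)) h.2.2.1 h.2.2.2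
      exact ⟨h1, h2, h3, h4⟩
    have around' : ∀ {x}, Around G T R b x → Around G T R a x := fun {x} h => by
      obtain ⟨h1, h2⟩ := c.swap.near_of_mid hG haT hab.symm nbT nbTa h.1 h.2.1
      obtain ⟨h3, h4⟩ := c.swap.near_of_mid hG (by rw [← c.comm]; exact hRa) (c.mR hab.symm)
        (fun e => nbT (by rw [← c.comm] at e; simpa [c.rr] using c.mR e))
        (fun e => nbTa (by rw [← c.comm] at e; simpa [c.rr] using c.mR e)) h.2.2.1 h.2.2.2
      exact ⟨h1, h2, h3, h4⟩
    by_cases hm : ∃ x, Near G x a ∧ Near G x (R a)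
    · obtain ⟨x, h, h'⟩ := hm
      obtain ⟨y, hy⟩ := c.exists_around_of_mid hG haT naR naRTa h h'
      exact hno (c.meets_of_around hG ha hb hab nbT naRb hy (around hy))
    by_cases hm' : ∃ x, Near G x b ∧ Near G x (T b)
    · obtain ⟨x, h, h'⟩ := hm'
      obtain ⟨y, hy⟩ := c.swap.exists_around_of_mid hG hbR nbT
        (by rw [← c.comm]; exact nRTb) h h'
      exact hno (c.meets_of_around hG ha hb hab nbT naRb (c.around_swap (around' hy))
        (c.around_swap hy))
    exact c.false_of_no_mid hG hb hab haT naRb hm hm'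

/-- The local criterion holds as soon as a vertex of `A` is near a vertex of `B`. -/
theorem meets (c : Config G R S T A B) (hG : Bridged G) (ha : a ∈ A) (hb : b ∈ B)
    (hab : Near G a b) : Meets G R S T A B := by
  by_cases hR : Near G a (R b)
  · by_cases hT : Near G a (T b)
    · exact c.meets_of_both hG ha hb hab hT hR
    · exact meets_of_swap (c.swap.meets_of_not_near hG hb ha hab.symm
        fun h => hT (c.iT.1 h.symm))
  · exact c.meets_of_not_near hG ha hb hab hR

end Config

/-! ### Orbits of dihedral groups -/

section Orbit

variable {G : SimpleGraph V} {W : Type*} [Group W] [MulAction W V]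

/-- If `v` is near its image under an element of order 4 or 5, then its orbit under this element is
a clique. -/
theorem near_pow_smul (hG : Bridged G) (hm : ∀ (g : W) {x y : V}, Near G x y → Near G (g • x) (g • y))
    {ρ : W} {n : ℕ} (hn : n = 4 ∨ n = 5) (hρ : ρ ^ n = 1) {v : V} (h : Near G v (ρ • v)) (i : ℕ) :
    Near G v (ρ ^ i • v) := by
  have h0 : Near G v v := by simp [Near]
  have shift : ∀ k {j}, Near G v (ρ ^ j • v) → Near G (ρ ^ k • v) (ρ ^ (k + j) • v) :=
    fun k j h => by simpa [pow_add, mul_smul] using hm (ρ ^ k) h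
  have h1 : Near G v (ρ ^ 1 • v) := by rwa [pow_one]
  have back : ∀ {k j}, k + j = n → Near G v (ρ ^ j • v) → Near G v (ρ ^ k • v) := by
    intro k j e h
    have := shift k h
    rw [e, hρ, one_smul] at this
    exact this.symm
  have h2 : Near G v (ρ ^ 2 • v) := by
    rcases hn with rfl | rfl
    · rcases hG.quad h1 (shift 1 h1) (shift 2 h1) (back (k := 3) (j := 1) rfl h1).symm with e | e
      · exact e
      · simpa [pow_succ', mul_smul] using hm ρ⁻¹ e
    · by_contra hno
      have e := hG.ear h1 (shift 1 h1) (shift 2 h1) (shift 3 h1)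
        (back (k := 4) (j := 1) rfl h1).symm hno fun h => hno (back (k := 2) (j := 3) rfl h)
      have e' := hm ρ e
      rw [← mul_smul, ← mul_smul, ← pow_succ', ← pow_succ', hρ, one_smul] at e'
      exact hno e'.symm
  have hlt : ∀ j < n, Near G v (ρ ^ j • v) := by
    rcases hn with rfl | rfl <;> intro j hj <;> interval_cases j
    · simpa using h0
    · exact h1
    · exact h2
    · exact back (k := 3) (j := 1) rfl h1
    · simpa using h0
    · exact h1
    · exact h2
    · exact back (k := 3) (j := 2) rfl h2
    · exact back (k := 4) (j := 1) rfl h1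
  rw [pow_eq_pow_mod i hρ]
  exact hlt _ (Nat.mod_lt _ (by omega))

/-- Let `s`, `t` be involutions with `s * t` of order 4 or 5. If `v` is near `s • v`, and `s • v` is
near `t • v`, then the orbit of `v` under the dihedral group generated by `s` and `t` is a clique.
The orbits of `v` and of `s • v` under the rotations are cliques; the neighbourhoods in the second
of the vertices of the first are nested, and have the same size, hence they coincide. -/
theorem near_smul_of_mem_closure (hG : Bridged G)
    (hm : ∀ (g : W) {x y : V}, Near G x y → Near G (g • x) (g • y)) {s t : W} (hs : s * s = 1)
    (ht : t * t = 1) {n : ℕ} (hn : n = 4 ∨ n = 5) (hst : (s * t) ^ n = 1) {v : V}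
    (hv : Near G v (s • v)) (hv' : Near G (s • v) (t • v)) {g : W}
    (hg : g ∈ Subgroup.closure {s, t}) : Near G v (g • v) := by
  set ρ := s * t with hρ
  have hρv : Near G v (ρ • v) := by simpa [← mul_smul, hs, hρ] using hm s hv'
  have hrot := near_pow_smul hG hm hn hst hρv
  -- the reflection `s` conjugates a rotation to its inverse
  have hsc : ∀ i, s * ρ ^ i = ρ ^ ((n - 1) * i) * s := by
    have h1 : SemiconjBy s ρ (ρ ^ (n - 1)) := by
      have e : ρ ^ (n - 1) * ρ = 1 := by
        rw [← pow_succ, Nat.sub_add_cancel (by omega), hst]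
      have e' : ρ ^ (n - 1) = t * s := by
        rw [eq_inv_of_mul_eq_one_left e, hρ, mul_inv_rev, inv_eq_of_mul_eq_one_left hs,
          inv_eq_of_mul_eq_one_left ht]
      rw [SemiconjBy, e', hρ, ← mul_assoc, hs, one_mul, mul_assoc, hs, mul_one]
    intro i
    rw [pow_mul]
    exact (h1.pow_right i).eq
  have clique : ∀ i j, Near G (ρ ^ i • s • v) (ρ ^ j • s • v) := by
    have h0 : ∀ k, Near G (s • v) (ρ ^ k • s • v) := fun k => by
      have := hm s (hrot ((n - 1) * k))
      have e : s * ρ ^ ((n - 1) * k) = ρ ^ k * s := by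
        have h := hsc k
        calc s * ρ ^ ((n - 1) * k) = s * (ρ ^ ((n - 1) * k) * s) * s := by
              rw [mul_assoc, mul_assoc, hs, mul_one]
          _ = ρ ^ k * s := by rw [← h, ← mul_assoc, hs, one_mul]
      rwa [← mul_smul, e, mul_smul] at this
    intro i j
    have := hm (ρ ^ i) (h0 (j + (n - 1) * i))
    rw [← mul_smul (ρ ^ i) (ρ ^ _), ← pow_add] at this
    have e : i + (j + (n - 1) * i) = j + n * i := by
      obtain ⟨m, rfl⟩ : ∃ m, n = m + 1 := ⟨n - 1, by omega⟩
      simp only [Nat.add_sub_cancel]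
      ring
    rwa [e, pow_add ρ j, pow_mul, hst, one_pow, mul_one] at this
  have succ_iff : ∀ j, Near G (ρ • v) (ρ ^ (j + 1) • s • v) ↔ Near G v (ρ ^ j • s • v) := by
    intro j
    constructor
    · intro h
      simpa [pow_succ', mul_smul] using hm ρ⁻¹ h
    · intro h
      simpa [pow_succ', mul_smul] using hm ρ h
  have nested : (∀ j, Near G v (ρ ^ j • s • v) → Near G v (ρ ^ (j + 1) • s • v)) ∨
      ∀ j, Near G v (ρ ^ (j + 1) • s • v) → Near G v (ρ ^ j • s • v) := by
    by_contra! hno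
    obtain ⟨⟨j, hj, hj'⟩, k, hk, hk'⟩ := hno
    rcases hG.quad hk (clique (k + 1) (j + 1)) ((succ_iff j).2 hj).symm hρv.symm with h | h
    · exact hj' h
    · exact hk' ((succ_iff k).1 h.symm)
  have hrefl : ∀ i, Near G v (ρ ^ i • s • v) := by
    intro i
    rcases nested with h | h
    · induction i with
      | zero => simpa using hv
      | succ i ih => exact h i ih
    · have key : ∀ k, Near G v (ρ ^ (i + k) • s • v) → Near G v (ρ ^ i • s • v) := by
        intro k
        induction k with
        | zero => exact id
        | succ k ih => exact fun hk => ih (h _ hk)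
      refine key ((n - 1) * i) ?_
      have e : i + (n - 1) * i = n * i := by
        obtain ⟨m, rfl⟩ : ∃ m, n = m + 1 := ⟨n - 1, by omega⟩
        simp only [Nat.add_sub_cancel]
        ring
      rw [e, pow_mul, hst, one_pow, one_smul]
      exact hv
  have hform : ∃ i, g = ρ ^ i ∨ g = ρ ^ i * s := by
    have left_s : ∀ y, (∃ i, y = ρ ^ i ∨ y = ρ ^ i * s) → ∃ i, s * y = ρ ^ i ∨ s * y = ρ ^ i * s := by
      rintro y ⟨i, rfl | rfl⟩
      · exact ⟨_, Or.inr (hsc i)⟩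
      · exact ⟨(n - 1) * i, Or.inl (by rw [← mul_assoc, hsc, mul_assoc, hs, mul_one])⟩
    have left_ρ : ∀ y, (∃ i, y = ρ ^ i ∨ y = ρ ^ i * s) →
        ∃ i, ρ * y = ρ ^ i ∨ ρ * y = ρ ^ i * s := by
      rintro y ⟨i, rfl | rfl⟩
      · exact ⟨i + 1, Or.inl (pow_succ' ρ i).symm⟩
      · exact ⟨i + 1, Or.inr (by rw [← mul_assoc, pow_succ' ρ i])⟩
    have left_t : ∀ y, (∃ i, y = ρ ^ i ∨ y = ρ ^ i * s) →
        ∃ i, t * y = ρ ^ i ∨ t * y = ρ ^ i * s := by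
      intro y hy
      have e : t = s * ρ := by rw [hρ, ← mul_assoc, hs, one_mul]
      have := left_s _ (left_ρ y hy)
      rwa [← mul_assoc, ← e] at this
    induction hg using Subgroup.closure_induction_left with
    | one => exact ⟨0, Or.inl (pow_zero ρ).symm⟩
    | mul_left x hx y _ ih =>
      rcases hx with rfl | rfl
      · exact left_s y ih
      · exact left_t y ih
    | inv_mul_cancel x hx y _ ih =>
      rcases hx with rfl | rfl
      · rw [inv_eq_of_mul_eq_one_left hs]
        exact left_s y ih
      · rw [inv_eq_of_mul_eq_one_left ht]
        exact left_t y ih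
  obtain ⟨i, rfl | rfl⟩ := hform
  · exact hrot i
  · rw [mul_smul]
    exact hrefl i

/-- An orbit of a subgroup all of whose elements move `v` by at most 1 is a stable clique. -/
theorem isClique_orbit (hG : Bridged G)
    (hm : ∀ (g : W) {x y : V}, Near G x y → Near G (g • x) (g • y)) (K : Subgroup W) {v : V}
    (h : ∀ g ∈ K, Near G v (g • v)) :
    G.IsClique ((fun g : W => g • v) '' K) ∧
      ∀ g ∈ K, g • ((fun g : W => g • v) '' (K : Set W)) = (fun g : W => g • v) '' K := by
  constructor
  · rintro _ ⟨g, hg, rfl⟩ _ ⟨g', hg', rfl⟩ hne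
    refine hG.adj_of ?_ hne
    have := hm g (h _ (K.mul_mem (K.inv_mem hg) hg'))
    rwa [← mul_smul, mul_inv_cancel_left] at this
  · intro g hg
    ext x
    rw [Set.mem_smul_set_iff_inv_smul_mem]
    constructor
    · rintro ⟨k, hk, e⟩
      exact ⟨g * k, K.mul_mem hg hk, by
        simp only at e ⊢
        rw [mul_smul, e, smul_inv_smul]⟩
    · rintro ⟨k, hk, rfl⟩
      exact ⟨g⁻¹ * k, K.mul_mem (K.inv_mem hg) hk, mul_smul _ _ _⟩

end Orbit

/-- Simplicial automorphisms do not increase distances in the 1-skeleton. -/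
theorem dist_smul_le {W : Type*} [Group W] [MulAction W V] {X : AbstractSimplicialComplex V}
    (hc : (oneSkeleton X.toPreAbstractSimplicialComplex).Connected)
    (h : ∀ g : W, ∀ σ ∈ X.faces, translate g σ ∈ X.faces) (g : W) (x y : V) :
    (oneSkeleton X.toPreAbstractSimplicialComplex).dist (g • x) (g • y) ≤
      (oneSkeleton X.toPreAbstractSimplicialComplex).dist x y := by
  let f : oneSkeleton X.toPreAbstractSimplicialComplex →g
      oneSkeleton X.toPreAbstractSimplicialComplex :=
    { toFun := fun x => g • x
      map_rel' := by
        rintro a b ⟨hne, σ, hσ, ha, hb⟩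
        refine ⟨fun e => hne (MulAction.injective g e), _, h g σ hσ, ?_, ?_⟩
        · exact Finset.mem_map.2 ⟨a, ha, rfl⟩
        · exact Finset.mem_map.2 ⟨b, hb, rfl⟩ }
  obtain ⟨w, hw⟩ := hc.exists_walk_length_eq_dist x y
  rw [← hw, ← SimpleGraph.Walk.length_map f w]
  exact SimpleGraph.dist_le _

theorem dist_smul {W : Type*} [Group W] [MulAction W V] {X : AbstractSimplicialComplex V}
    (hc : (oneSkeleton X.toPreAbstractSimplicialComplex).Connected)
    (h : ∀ g : W, ∀ σ ∈ X.faces, translate g σ ∈ X.faces) (g : W) (x y : V) :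
    (oneSkeleton X.toPreAbstractSimplicialComplex).dist (g • x) (g • y) =
      (oneSkeleton X.toPreAbstractSimplicialComplex).dist x y := by
  refine le_antisymm (dist_smul_le hc h g x y) ?_
  simpa using dist_smul_le hc h g⁻¹ (g • x) (g • y)

theorem exists_near_of_setDist {G : SimpleGraph V} {A B : Set V} (h : setDist G A B = 1) :
    ∃ a ∈ A, ∃ b ∈ B, Near G a b := by
  have hlt : setDist G A B < 2 := by
    rw [h]
    exact_mod_cast (one_lt_two : 1 < 2)
  simp only [setDist, iInf_lt_iff] at hlt
  obtain ⟨a, ha, b, hb, hab⟩ := hlt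
  refine ⟨a, ha, b, hb, ?_⟩
  have hle : G.edist a b ≤ 1 := ENat.lt_add_one_iff (by simp) |>.1 (by rwa [one_add_one_eq_two])
  exact ENat.toNat_le_of_le_natCast hle

end Systolic

theorem mainTheorem2 {W : Type*} [Group W] (cs : CoxeterSystem Systolic.triangle245 W)
    (r s t : W) (hr : r = cs.simple 0) (hs : s = cs.simple 1) (ht : t = cs.simple 2)
    {V : Type*} [MulAction W V] (X : AbstractSimplicialComplex V)
    (hX : Systolic.IsSystolic X) (hW : Systolic.IsGeometricAction W X)
    (A B : Set V)
    (hA : (Systolic.oneSkeleton X.toPreAbstractSimplicialComplex).IsClique A)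
    (hB : (Systolic.oneSkeleton X.toPreAbstractSimplicialComplex).IsClique B)
    (hAfix : ∀ g ∈ Subgroup.closure {s, t}, g • A = A)
    (hBfix : ∀ g ∈ Subgroup.closure {r, s}, g • B = B)
    (hAB : Systolic.setDist (Systolic.oneSkeleton X.toPreAbstractSimplicialComplex) A B = 1) :
    ∃ A' B' : Set V,
      (Systolic.oneSkeleton X.toPreAbstractSimplicialComplex).IsClique A' ∧
      (Systolic.oneSkeleton X.toPreAbstractSimplicialComplex).IsClique B' ∧
      (∀ g ∈ Subgroup.closure {s, t}, g • A' = A') ∧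
      (∀ g ∈ Subgroup.closure {r, s}, g • B' = B') ∧
      (A' ∩ B').Nonempty := by
  open Systolic in
  have hG := hX.bridged
  set G := oneSkeleton X.toPreAbstractSimplicialComplex
  have hdist : ∀ (g : W) (x y : V), G.dist (g • x) (g • y) = G.dist x y :=
    dist_smul hX.connected hW.simplicial
  have hm : ∀ (g : W) {x y : V}, Near G x y → Near G (g • x) (g • y) := fun g x y h => by
    rwa [Near, hdist]
  have hrr : r * r = 1 := hr ▸ cs.simple_mul_simple_self 0
  have hss : s * s = 1 := hs ▸ cs.simple_mul_simple_self 1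
  have htt : t * t = 1 := ht ▸ cs.simple_mul_simple_self 2
  have hst : (s * t) ^ 5 = 1 := by
    rw [hs, ht]
    exact cs.simple_mul_simple_pow 1 2
  have hsr : (s * r) ^ 4 = 1 := by
    rw [hs, hr]
    exact cs.simple_mul_simple_pow 1 0
  have hrt : r * t = t * r := by
    have h : (r * t) ^ 2 = 1 := by
      rw [hr, ht]
      exact cs.simple_mul_simple_pow 0 2
    rw [pow_two] at h
    rw [eq_inv_of_mul_eq_one_left h, mul_inv_rev, inv_eq_of_mul_eq_one_left hrr,
      inv_eq_of_mul_eq_one_left htt]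
  have hcl : Subgroup.closure {r, s} = Subgroup.closure {s, r} := by rw [Set.pair_comm]
  have orbA : ∀ {v}, Near G v (s • v) → Near G (s • v) (t • v) →
      ∀ g ∈ Subgroup.closure {s, t}, Near G v (g • v) := fun h h' g hg =>
    near_smul_of_mem_closure hG hm hss htt (Or.inr rfl) hst h h' hg
  have orbB : ∀ {v}, Near G v (s • v) → Near G (s • v) (r • v) →
      ∀ g ∈ Subgroup.closure {r, s}, Near G v (g • v) := fun h h' g hg =>
    near_smul_of_mem_closure hG hm hss hrr (Or.inl rfl) hsr h h' (hcl ▸ hg)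
  have mem : ∀ {K : Subgroup W} {C : Set V}, (∀ g ∈ K, g • C = C) → ∀ {g x}, g ∈ K → x ∈ C →
      g • x ∈ C := fun h g x hg hx => h g hg ▸ Set.smul_mem_smul_set hx
  have near : ∀ {C : Set V}, G.IsClique C → ∀ {x y}, x ∈ C → y ∈ C → Near G x y := by
    intro C hC x y hx hy
    by_cases e : x = y
    · exact hG.dist_le_one.2 (Or.inl e)
    · exact hG.dist_le_one.2 (Or.inr (hC hx hy e))
  have inv : ∀ {g : W}, g * g = 1 → ∀ x : V, g • g • x = x := fun h x => by
    rw [← mul_smul, h, one_smul]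
  have sA : s ∈ Subgroup.closure {s, t} := Subgroup.subset_closure (by simp)
  have tA : t ∈ Subgroup.closure {s, t} := Subgroup.subset_closure (by simp)
  have sB : s ∈ Subgroup.closure {r, s} := Subgroup.subset_closure (by simp)
  have rB : r ∈ Subgroup.closure {r, s} := Subgroup.subset_closure (by simp)
  have c : Config G (fun x => r • x) (fun x => s • x) (fun x => t • x) A B :=
    { rr := inv hrr
      ss := inv hss
      tt := inv htt
      comm := fun x => by simp only [← mul_smul, hrt]
      distR := hdist r
      distS := hdist s
      distT := hdist t
      memAS := mem hAfix sA
      memAT := mem hAfix tA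
      memBS := mem hBfix sB
      memBR := mem hBfix rB
      nearA := near hA
      nearB := near hB }
  obtain ⟨a, ha, b, hb, hab⟩ := exists_near_of_setDist hAB
  have self : ∀ (K : Subgroup W) (v : V), v ∈ (fun g : W => g • v) '' (K : Set W) :=
    fun K v => ⟨1, K.one_mem, one_smul _ _⟩
  rcases c.meets hG ha hb hab with ⟨v, hv, h⟩ | ⟨v, hv, h⟩ | ⟨v, h, hT, hR⟩
  · obtain ⟨h1, h2⟩ := isClique_orbit hG hm _ (orbA (near hB hv (mem hBfix sB hv)) h)
    exact ⟨_, B, h1, hB, h2, hBfix, v, self _ v, hv⟩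
  · obtain ⟨h1, h2⟩ := isClique_orbit hG hm _ (orbB (near hA hv (mem hAfix sA hv)) h)
    exact ⟨A, _, hA, h1, hAfix, h2, v, hv, self _ v⟩
  · obtain ⟨h1, h2⟩ := isClique_orbit hG hm _ (orbA h hT)
    obtain ⟨h3, h4⟩ := isClique_orbit hG hm _ (orbB h hR)
    exact ⟨_, _, h1, h3, h2, h4, v, self _ v, self _ v⟩
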